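/- Let $kr_1(n,m)$ be the number of partitions $\lambda_1\le\lambda_2\le\dots\le\lambda_m$ of $n$ into $m$ positive parts (the empty partition being the only partition of $0$) such that (a) no two consecutive integers both occur as parts; (b) odd parts do not repeat; (c) whenever $\lambda_i,\lambda_{i+1},\lambda_{i+2}$ are three contiguous parts such that $\lambda_{i+1}$ is even and appears more than once in the partition, one has $|\lambda_i-\lambda_{i+2}|\ge 4$; (d) $2+2$ does not occur as a sub-partition (the part $2$ occurs at most once). Write $(a;x)_n=\prod_{r=0}^{n-1}(1-ax^r)$. A *base partition* (with its moveable singletons left out) is a finite, possibly empty, sequence of pieces, listed from the smallest to the largest. Each piece is a pair $[k,k]$ of repeating parts, a pair $[k,k+1]$ of consecutive parts, or a block $[k-1,k],k,[k+2,k+2]$, which consists of two pairs and a singleton between them. The sequence has to be tightly packed: the smallest pair is $[1,1]$, $[1,2]$ or $[2,2]$; and if the largest pair of a piece is $[k,k]$, then the smallest pair of the next piece is $[k+1,k+1]$, $[k+1,k+2]$ or $[k+2,k+2]$, while if it is $[k,k+1]$, then the smallest pair of the next piece is $[k+1,k+2]$, $[k+2,k+2]$ or $[k+2,k+3]$. For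 integers $m_1,m_2,m_3,m\ge 0$ let $$P(m_1,m_2,m_3,m+1;q)=\sum_\beta q^{|\beta|},$$ where $|\beta|$ is the sum of all the parts of $\beta$ and $\beta$ runs over the finitely many base partitions that have exactly $m_1$ pairs of repeating parts and $m_2$ pairs of consecutive parts outside blocks, exactly $m_3$ blocks, and largest pair $[m,m]$ or $[m,m+1]$; for $m_1=m_2=m_3=0$ the empty base partition is counted under $m=0$, so that $P(0,0,0,1;q)=1$ and $P(0,0,0,m+1;q)=0$ for $m\ge 1$. Each $P(m_1,m_2,m_3,m+1;q)$ is thus a polynomial in $q$ with non-negative integer coefficients. **Theorem.** As formal power series in $q$ and $t$, $$\sum_{m,n\ge 0}kr_1(n,m)\,q^nt^m=\sum_{\substack{m_1,m_2,m_3,\\ m,n_{12},i,j,k\ge 0}}\frac{P(m_1,m_2,m_3,m+1;q^2)\;q^{2mn_{12}+2n_{12}^2+i+4j+(2m_1+2m_2+5m_3+n_{12}+i+2j+k)^2}}{(q^2;q^2)_{n_{12}}\,(q^6;q^6)_{m_1+m_2+2m_3}\,(q^2;q^2)_i\,(q^4;q^4)_j}\;t^{2m_1+2m_2+5m_3+n_{12}+i+2j+k},$$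 where the series on the right converges coefficientwise. Moreover, this series is evidently positive: every summand, expanded as a power series in $q$ and $t$, has only non-negative coefficients. -/

import Mathlib

open scoped MvPowerSeries.WithPiTopology

/-! ### The partitions being counted -/

/-- The conditions (a)-(d). Here `l` is the list of the parts in non-decreasing order. -/
structure KROne {n : ℕ} (p : n.Partition) : Prop where
  /-- (a) no two consecutive integers are both parts -/
  no_consecutive : ∀ x ∈ p.parts, x + 1 ∉ p.parts
  /-- (b) odd parts do not repeat -/
  odd_not_repeated : ∀ x ∈ p.parts, Odd x → p.parts.count x = 1
  /-- (c) if the middle one of three contiguous parts is even and appears more than once in the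
  partition, then the outer two differ by at least `4` -/
  distance_two : ∀ (i : ℕ) (a b c : ℕ),
    (p.parts.sort (· ≤ ·))[i]? = some a →
    (p.parts.sort (· ≤ ·))[i + 1]? = some b →
    (p.parts.sort (· ≤ ·))[i + 2]? = some c →
    Even b → 1 < p.parts.count b → 4 ≤ |(a : ℤ) - (c : ℤ)|
  /-- (d) `2+2` is not a sub-partition -/
  no_two_two : p.parts.count 2 ≤ 1

/-- The number of partitions of `n` into `m` parts satisfying (a)-(d). -/
noncomputable def krOne (n m : ℕ) : ℕ :=
  Nat.card {p : n.Partition // p.parts.card = m ∧ KROne p}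

/-! ### Base partitions and the polynomials `P` -/

/-- The pieces of a base partition: a pair `[k, k]` of two repeating parts, a pair `[k, k+1]` of two
consecutive parts, or a block `[k, k+1], k+1, [k+3, k+3]`, which consists of two pairs that enclose
an immobile singleton. -/
inductive Piece : Type
  | rep (k : ℕ)
  | con (k : ℕ)
  | block (k : ℕ)

namespace Piece

/-- The parts that make up a piece. -/
def parts : Piece → List ℕ
  | rep k => [k, k]
  | con k => [k, k + 1]
  | block k => [k, k + 1, k + 1, k + 3, k + 3]

/-- The smallest pair of a piece. -/
def firstPair : Piece → ℕ × ℕ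
  | rep k => (k, k)
  | con k => (k, k + 1)
  | block k => (k, k + 1)

/-- The largest pair of a piece. -/
def lastPair : Piece → ℕ × ℕ
  | rep k => (k, k)
  | con k => (k, k + 1)
  | block k => (k + 3, k + 3)

def isRep : Piece → Bool
  | rep _ => true
  | _ => false

def isCon : Piece → Bool
  | con _ => true
  | _ => false

def isBlock : Piece → Bool
  | block _ => true
  | _ => false

end Piece

/-- `Tight x y`: the pair `y` stands right after the pair `x`, with no singleton in between, and
cannot be moved further back. After `[k, k]` these are `[k+1, k+1]`, `[k+1, k+2]`, `[k+2, k+2]`;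
after `[k, k+1]` they are `[k+1, k+2]`, `[k+2, k+2]`, `[k+2, k+3]`. -/
def Tight (x y : ℕ × ℕ) : Prop :=
  (x.2 = x.1 ∧ (y = (x.1 + 1, x.1 + 1) ∨ y = (x.1 + 1, x.1 + 2) ∨ y = (x.1 + 2, x.1 + 2))) ∨
  (x.2 = x.1 + 1 ∧ (y = (x.1 + 1, x.1 + 2) ∨ y = (x.1 + 2, x.1 + 2) ∨ y = (x.1 + 2, x.1 + 3)))

/-- A base partition without its moveable singletons, listed by its pieces from the smallest to the
largest: the smallest pair is `[1, 1]`, `[1, 2]` or `[2, 2]`, and the pieces are tightly packed. -/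
def IsBase (β : List Piece) : Prop :=
  (∀ p ∈ β.head?, p.firstPair = (1, 1) ∨ p.firstPair = (1, 2) ∨ p.firstPair = (2, 2)) ∧
  β.IsChain (fun p r => Tight p.lastPair r.firstPair)

/-- The smallest possible value of a moveable singleton that follows `β`: it is `m + 1` if the
largest pair is `[m, m]` or `[m, m+1]`, and `1` if there is no pair. -/
def nextSingleton (β : List Piece) : ℕ :=
  match β.getLast? with
  | none => 1
  | some p => p.lastPair.1 + 1

/-- The sum of all the parts. -/
def baseWeight (β : List Piece) : ℕ := (β.map fun p => p.parts.sum).sum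

/-- The base partitions with `m₁` pairs of repeating parts and `m₂` pairs of consecutive parts
outside blocks, with `m₃` blocks, and with `M` as the smallest possible moveable singleton. -/
def basePartitions (m₁ m₂ m₃ M : ℕ) : Set (List Piece) :=
  {β | IsBase β ∧ β.countP Piece.isRep = m₁ ∧ β.countP Piece.isCon = m₂ ∧
    β.countP Piece.isBlock = m₃ ∧ nextSingleton β = M}

/-- The polynomial `P(m₁, m₂, m₃, M; q)`, the generating function of the base partitions. The sum
is finite by `basePartitions_finite`. -/
noncomputable def P (m₁ m₂ m₃ M : ℕ) : Polynomial ℕ :=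
  ∑ᶠ β ∈ basePartitions m₁ m₂ m₃ M, Polynomial.X ^ baseWeight β

theorem lists_finite {α : Type*} {s : Set α} (hs : s.Finite) (n : ℕ) :
    {l : List α | l.length = n ∧ ∀ x ∈ l, x ∈ s}.Finite := by
  induction n with
  | zero =>
    refine (Set.finite_singleton ([] : List α)).subset ?_
    rintro l ⟨hl, -⟩
    simpa using hl
  | succ n ih =>
    refine ((hs.prod ih).image (fun x : α × List α => x.1 :: x.2)).subset ?_
    rintro (_ | ⟨a, l⟩) ⟨hl, h⟩
    · simp at hl
    · refine ⟨(a, l), ⟨h a (by simp), by simpa using hl, fun x hx => h x (by simp [hx])⟩, rfl⟩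

def Piece.low : Piece → ℕ
  | rep k => k
  | con k => k
  | block k => k

theorem low_lt_nextSingleton (β : List Piece)
    (h : β.IsChain (fun p r => Tight p.lastPair r.firstPair)) :
    ∀ p ∈ β, p.low < nextSingleton β := by
  induction β with
  | nil => simp
  | cons a l ih =>
    rcases l with _ | ⟨b, l⟩
    · intro p hp
      obtain rfl : p = a := by simpa using hp
      rcases p with k | k | k <;> simp [nextSingleton, Piece.low, Piece.lastPair]
    · have hab : Tight a.lastPair b.firstPair := by simpa using (List.isChain_cons_cons.mp h).1
      have ih' := ih (List.isChain_cons_cons.mp h).2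
      have hn : nextSingleton (a :: b :: l) = nextSingleton (b :: l) := by
        simp [nextSingleton, List.getLast?_cons_cons]
      rw [hn]
      intro p hp
      rcases List.mem_cons.mp hp with rfl | hp
      · refine lt_trans ?_ (ih' b (by simp))
        rcases p with k | k | k <;> rcases b with j | j | j <;>
          simp [Tight, Piece.low, Piece.lastPair, Piece.firstPair] at hab ⊢ <;> omega
      · exact ih' p hp

theorem basePartitions_finite (m₁ m₂ m₃ M : ℕ) : (basePartitions m₁ m₂ m₃ M).Finite := by
  have hs : {p : Piece | p.low < M}.Finite := by
    refine (((Set.finite_lt_nat M).image Piece.rep).union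
      (((Set.finite_lt_nat M).image Piece.con).union
        ((Set.finite_lt_nat M).image Piece.block))).subset ?_
    rintro (k | k | k) hk
    · exact Or.inl ⟨k, hk, rfl⟩
    · exact Or.inr (Or.inl ⟨k, hk, rfl⟩)
    · exact Or.inr (Or.inr ⟨k, hk, rfl⟩)
  refine (lists_finite hs (m₁ + m₂ + m₃)).subset ?_
  rintro β ⟨hβ, h₁, h₂, h₃, hM⟩
  refine ⟨?_, fun p hp => hM ▸ low_lt_nextSingleton β hβ.2 p hp⟩
  rw [← h₁, ← h₂, ← h₃]
  clear hβ h₁ h₂ h₃ hM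
  induction β with
  | nil => rfl
  | cons a l ih =>
    rcases a with k | k | k <;>
      simp [List.countP_cons, Piece.isRep, Piece.isCon, Piece.isBlock, ih] <;> omega

/-! ### The two series, as formal power series in `q` and `t` with integer coefficients -/

/-- Formal power series in `q` and `t`, with the topology of coefficientwise convergence (for the
discrete topology of `ℤ`). -/
abbrev QTSeries : Type := MvPowerSeries (Fin 2) ℤ

noncomputable def qvar : QTSeries := MvPowerSeries.X 0

noncomputable def tvar : QTSeries := MvPowerSeries.X 1

/-- `(a; x)_n = (1 - a) (1 - a x) ⋯ (1 - a x^(n-1))`. -/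
noncomputable def qPochhammer (a x : QTSeries) (n : ℕ) : QTSeries :=
  ∏ k ∈ Finset.range n, (1 - a * x ^ k)

/-- `1 / (q^s; q^s)_n`, where `s ≥ 1`. -/
noncomputable def invPochhammer (s n : ℕ) : QTSeries :=
  MvPowerSeries.invOfUnit (qPochhammer (qvar ^ s) (qvar ^ s) n) 1

theorem qPochhammer_mul_invPochhammer (s n : ℕ) (hs : 0 < s) :
    qPochhammer (qvar ^ s) (qvar ^ s) n * invPochhammer s n = 1 := by
  refine MvPowerSeries.mul_invOfUnit _ _ ?_
  simp [qPochhammer, qvar, hs.ne']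

/-- The generating function `∑ kr₁(n, m) q^n t^m`. -/
noncomputable def krSeries : QTSeries := fun d => (krOne (d 0) (d 1) : ℤ)

/-- The summand of the multiple series. -/
noncomputable def krTerm (m₁ m₂ m₃ m n₁₂ i j k : ℕ) : QTSeries :=
  Polynomial.aeval (qvar ^ 2) (P m₁ m₂ m₃ (m + 1))
    * qvar ^ (2 * m * n₁₂ + 2 * n₁₂ ^ 2 + i + 4 * j
        + (2 * m₁ + 2 * m₂ + 5 * m₃ + n₁₂ + i + 2 * j + k) ^ 2)
    * (invPochhammer 2 n₁₂ * invPochhammer 6 (m₁ + m₂ + 2 * m₃)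
        * invPochhammer 2 i * invPochhammer 4 j)
    * tvar ^ (2 * m₁ + 2 * m₂ + 5 * m₃ + n₁₂ + i + 2 * j + k)

/-! ### The partitions as lists built from single and repeated parts -/

/-! The argument compares two evaluations of one product, with `s` marking the number of parts.

Removing the smallest single or repeated part of an admissible list leaves an admissible list with
larger lower bounds, and translation by 2 respects both gaps and parity. The resulting recurrences
close on the four sets `krSet 1 3`, `krSet 2 4`, `krSet 2 2`, `krSet 1 2`. Once `q^(N^2)` is divided
out of the generating function of lists of length `N`, they become `q`-difference equations in `s`.
The coefficient for `krSet 1 3` is then that of `s^N` in `L / (1 - s)`, where `L` is formally the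
product over `r ≥ 1` of `(1 + s q^(2r) + s^2 q^(4r)) / ((1 - s q^(2r-1)) (1 - s^2 q^(4r)))`
(`listGF_krSet_eq`). The factor `1 / (1 - s)` gives the sum over `k`, and Euler's expansions of the
two denominators give the sums over `i` and `j`.

There remains the numerator, which counts multisets in which every multiplicity is at most two, a
part `r` having weight `q^(2r)`. It has to be expanded over base partitions followed by `n₁₂`
singletons. Read such a multiset upwards, join equal or consecutive parts greedily into pairs, and
let `v` mark the pairs: this gives a `PairedSystem` of weight `v`. The contiguity relation
`PairedSystem.contiguous`, together with uniqueness of solutions, expresses the series at `v q^6` by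
the series at `v`. Comparing coefficients of `v^(p+1)` yields a recursion in `p` with the factor `1
- q^(6(p+1))`. Removing the first piece from a tightly packed sequence gives the same recursion
without that factor, so the packed sequences with `p` pairs have generating function `(q^6; q^6)_p`
times the part with `p` pairs (`packedGF_eq`). Setting `v = 1` recovers the numerator
(`atMostTwice_eq`).

Positivity follows factor by factor. -/

/-- Lists of parts in increasing order, built from single parts that are at least `c` and repeated
even parts that are at least `d`, with the distances required by the conditions (a)-(c). -/
inductive KRList : ℕ → ℕ → List ℕ → Prop
  | nil (c d : ℕ) : KRList c d []
  | single {c d a : ℕ} {l : List ℕ} : c ≤ a → KRList (a + 2) (a + 4) l → KRList c d (a :: l)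
  | double {c d a : ℕ} {l : List ℕ} : d ≤ a → Even a → KRList (a + 4) (a + 4) l →
      KRList c d (a :: a :: l)

namespace KRList

theorem lower_bound {c d : ℕ} {l : List ℕ} (h : KRList c d l) : ∀ x ∈ l, min c d ≤ x := by
  induction h with
  | nil => simp
  | single hc _ ih =>
    rintro x hx
    rcases List.mem_cons.mp hx with rfl | hx
    · omega
    · have := ih x hx
      omega
  | double hd _ _ ih =>
    rintro x hx
    rcases List.mem_cons.mp hx with rfl | hx
    · omega
    · rcases List.mem_cons.mp hx with rfl | hx
      · omega
      · have := ih x hx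
        omega

theorem pairwise {c d : ℕ} {l : List ℕ} (h : KRList c d l) : l.Pairwise (· ≤ ·) := by
  induction h with
  | nil => simp
  | single _ h ih =>
    refine List.pairwise_cons.mpr ⟨fun x hx => ?_, ih⟩
    have := h.lower_bound x hx
    omega
  | double _ _ h ih =>
    refine List.pairwise_cons.mpr ⟨fun x hx => ?_, List.pairwise_cons.mpr ⟨fun x hx => ?_, ih⟩⟩
    · rcases List.mem_cons.mp hx with rfl | hx
      · exact le_rfl
      · have := h.lower_bound x hx
        omega
    · have := h.lower_bound x hx
      omega

theorem succ_notMem {c d : ℕ} {l : List ℕ} (h : KRList c d l) : ∀ x ∈ l, x + 1 ∉ l := by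
  induction h with
  | nil => simp
  | single _ h ih =>
    intro x hx hx'
    have hb := h.lower_bound
    rcases List.mem_cons.mp hx with rfl | hx <;> rcases List.mem_cons.mp hx' with h' | hx'
    · omega
    · have := hb _ hx'
      omega
    · have := hb _ hx
      omega
    · exact ih x hx hx'
  | double _ _ h ih =>
    intro x hx hx'
    have hb := h.lower_bound
    simp only [List.mem_cons, or_self_left] at hx hx'
    rcases hx with rfl | hx <;> rcases hx' with h' | hx'
    · omega
    · have := hb _ hx'
      omega
    · have := hb _ hx
      omega
    · exact ih x hx hx'

/-- The alternative `c + 2` is needed because a repeated part that follows a single part is bounded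
through that single part, and may lie below `d`. -/
theorem count_of_one_lt {c d : ℕ} {l : List ℕ} (h : KRList c d l) :
    ∀ x, 1 < l.count x → Even x ∧ d ⊓ (c + 2) ≤ x := by
  induction h with
  | nil => simp
  | @single c d a l hc h ih =>
    intro x hx
    have hb := h.lower_bound
    by_cases hxa : x = a
    · subst hxa
      have : l.count x = 0 := List.count_eq_zero.mpr fun hm => by have := hb _ hm; omega
      rw [List.count_cons_self] at hx
      omega
    · rw [List.count_cons_of_ne (Ne.symm hxa)] at hx
      have := ih x hx
      exact ⟨this.1, by have := this.2; omega⟩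
  | @double c d a l hd he h ih =>
    intro x hx
    by_cases hxa : x = a
    · subst hxa
      exact ⟨he, by omega⟩
    · rw [List.count_cons_of_ne (Ne.symm hxa), List.count_cons_of_ne (Ne.symm hxa)] at hx
      have := ih x hx
      exact ⟨this.1, by have := this.2; omega⟩

theorem distance_two {c d : ℕ} {l : List ℕ} (h : KRList c d l) :
    ∀ (i u v w : ℕ), l[i]? = some u → l[i + 1]? = some v → l[i + 2]? = some w →
      1 < l.count v → u + 4 ≤ w := by
  induction h with
  | nil => simp
  | @single c d a l hc h ih =>
    intro i u v w hu hv hw hcount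
    have hb := h.lower_bound
    have hvl : v ∈ l := List.mem_of_getElem? (by simpa using hv)
    have hva : v ≠ a := by have := hb _ hvl; omega
    rw [List.count_cons_of_ne (Ne.symm hva)] at hcount
    rcases i with _ | i
    · obtain rfl : a = u := by simpa using hu
      have hwl : w ∈ l := List.mem_of_getElem? (by simpa using hw)
      have h1 := h.count_of_one_lt v hcount
      have h2 := h.pairwise
      rcases l with _ | ⟨v', _ | ⟨w', l⟩⟩
      · simp at hvl
      · simp at hw
      · obtain rfl : v' = v := by simpa using hv
        obtain rfl : w' = w := by simpa using hw
        have := (List.pairwise_cons.mp h2).1 w' (by simp)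
        omega
    · exact ih i u v w (by simpa using hu) (by simpa using hv) (by simpa using hw) hcount
  | @double c d a l hd he h ih =>
    intro i u v w hu hv hw hcount
    have hb := h.lower_bound
    rcases i with _ | _ | i
    · have hwl : w ∈ l := List.mem_of_getElem? (by simpa using hw)
      obtain rfl : a = u := by simpa using hu
      have := hb _ hwl
      omega
    · have hwl : w ∈ l := List.mem_of_getElem? (i := 1) (by simpa using hw)
      obtain rfl : a = u := by simpa using hu
      have := hb _ hwl
      omega
    · have hvl : v ∈ l := List.mem_of_getElem? (by simpa using hv)
      have hva : v ≠ a := by have := hb _ hvl; omega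
      rw [List.count_cons_of_ne (Ne.symm hva), List.count_cons_of_ne (Ne.symm hva)] at hcount
      exact ih i u v w (by simpa using hu) (by simpa using hv) (by simpa using hw) hcount

/-- The smallest part decides the constructor: `double` if it recurs, `single` otherwise. The
induction runs over a bound for the length because `double` removes two entries, and `c`, `d` vary
because they change with each removal. -/
theorem of_conditions (n : ℕ) : ∀ (l : List ℕ), l.length ≤ n → ∀ c d : ℕ,
    l.Pairwise (· ≤ ·) → (∀ x ∈ l, x + 1 ∉ l) → (∀ x ∈ l, Odd x → l.count x = 1) →
    (∀ (i u v w : ℕ), l[i]? = some u → l[i + 1]? = some v → l[i + 2]? = some w →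
      Even v → 1 < l.count v → u + 4 ≤ w) →
    (∀ x ∈ l, c ≤ x) → (∀ x, 1 < l.count x → d ≤ x) → KRList c d l := by
  induction n with
  | zero =>
    intro l hl
    obtain rfl : l = [] := List.length_eq_zero_iff.mp (by omega)
    exact fun c d _ _ _ _ _ _ => .nil c d
  | succ n ih =>
    rintro (_ | ⟨a, l⟩) hl c d hsort hcons hodd hdist hc hd
    · exact .nil c d
    have heven : ∀ x, 1 < (a :: l).count x → Even x := fun x hx => by
      by_contra hx'
      have hm : x ∈ a :: l := List.count_pos_iff.mp (by omega)
      have := hodd x hm (Nat.not_even_iff_odd.mp hx')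
      omega
    obtain ⟨hal, hsl⟩ := List.pairwise_cons.mp hsort
    by_cases hmem : a ∈ l
    · rcases l with _ | ⟨b, l⟩
      · simp at hmem
      obtain ⟨hbl, hsl'⟩ := List.pairwise_cons.mp hsl
      obtain rfl : a = b := by
        rcases List.mem_cons.mp hmem with h | h
        · exact h
        · exact le_antisymm (hal b (by simp)) (hbl a h)
      have hcount : 1 < (a :: a :: l).count a := by
        rw [List.count_cons_self, List.count_cons_self]
        omega
      have hgap : ∀ x ∈ l, a + 4 ≤ x := by
        rcases l with _ | ⟨w, l⟩
        · simp
        · have := hdist 0 a a w rfl rfl rfl (heven a hcount) hcount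
          intro x hx
          rcases List.mem_cons.mp hx with rfl | hx
          · exact this
          · exact this.trans ((List.pairwise_cons.mp hsl').1 x hx)
      have hne : ∀ x ∈ l, a ≠ x := fun x hx => by have := hgap x hx; omega
      have hc' : ∀ x ∈ l, (a :: a :: l).count x = l.count x := fun x hx => by
        rw [List.count_cons_of_ne (hne x hx), List.count_cons_of_ne (hne x hx)]
      refine .double (hd a hcount) (heven a hcount) (ih l ?_ _ _ hsl' ?_ ?_ ?_ hgap ?_)
      · simp only [List.length_cons] at hl
        omega
      · exact fun x hx hx' => hcons x (by simp [hx]) (by simp [hx'])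
      · exact fun x hx ho => (hc' x hx) ▸ hodd x (by simp [hx]) ho
      · intro i u v w hu hv hw he hcv
        exact hdist (i + 2) u v w (by simpa using hu) (by simpa using hv) (by simpa using hw) he
          (by rwa [hc' v (List.mem_of_getElem? hv)])
      · exact fun x hx => hgap x (List.count_pos_iff.mp (by omega))
    · have hgap : ∀ x ∈ l, a + 2 ≤ x := fun x hx => by
        have h1 := hal x hx
        have h2 : x ≠ a := fun h => hmem (h ▸ hx)
        have h3 : x ≠ a + 1 := fun h => hcons a (by simp) (by simp [← h, hx])
        omega
      have hc' : ∀ x ∈ l, (a :: l).count x = l.count x := fun x hx => by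
        rw [List.count_cons_of_ne]
        rintro rfl
        exact hmem hx
      refine .single (hc a (by simp)) (ih l ?_ _ _ hsl ?_ ?_ ?_ hgap ?_)
      · simp only [List.length_cons] at hl
        omega
      · exact fun x hx hx' => hcons x (by simp [hx]) (by simp [hx'])
      · exact fun x hx ho => (hc' x hx) ▸ hodd x (by simp [hx]) ho
      · intro i u v w hu hv hw he hcv
        exact hdist (i + 1) u v w (by simpa using hu) (by simpa using hv) (by simpa using hw) he
          (by rwa [hc' v (List.mem_of_getElem? hv)])
      · intro x hx
        have hxl : x ∈ l := List.count_pos_iff.mp (by omega)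
        rcases l with _ | ⟨v, l⟩
        · simp at hxl
        -- If the part right after `a` is repeated, condition (c) applies to `a, x, x`. Otherwise `v
        -- ≥ a + 2` and, since consecutive parts are excluded, `x ≥ v + 2`.
        by_cases hxv : x = v
        · subst hxv
          have hxl' : x ∈ l := by
            rw [List.count_cons_self] at hx
            exact List.count_pos_iff.mp (by omega)
          rcases l with _ | ⟨w, l⟩
          · simp at hxl'
          have h1 := (List.pairwise_cons.mp hsl).1 w (by simp)
          obtain rfl : x = w := by
            rcases List.mem_cons.mp hxl' with h | h
            · exact h
            · exact le_antisymm h1 ((List.pairwise_cons.mp (List.pairwise_cons.mp hsl).2).1 x h)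
          have hx2 : 1 < (a :: x :: x :: l).count x := by rwa [hc' x hxl]
          exact hdist 0 a x x rfl rfl rfl (heven x hx2) hx2
        · have h1 : v ≤ x := hal_le hsl hxl
          have h2 : x ≠ v + 1 := fun h => hcons v (by simp) (by simp [← h, hxl])
          have := hgap v (by simp)
          omega
where
  hal_le {v x : ℕ} {l : List ℕ} (h : (v :: l).Pairwise (· ≤ ·)) (hx : x ∈ v :: l) : v ≤ x := by
    rcases List.mem_cons.mp hx with rfl | hx
    · exact le_rfl
    · exact (List.pairwise_cons.mp h).1 x hx

end KRList

/-- The bound 3 for repeated parts encodes (d): repetitions of 1 are already excluded by parity, so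
only 2 has to be ruled out. -/
theorem krOne_iff {n : ℕ} (p : n.Partition) : KROne p ↔ KRList 1 3 (p.parts.sort (· ≤ ·)) := by
  have hcount (x : ℕ) : (p.parts.sort (· ≤ ·)).count x = p.parts.count x := by
    rw [← Multiset.coe_count, Multiset.sort_eq]
  have hmem (x : ℕ) : x ∈ p.parts.sort (· ≤ ·) ↔ x ∈ p.parts := Multiset.mem_sort _
  constructor
  · intro h
    refine KRList.of_conditions _ _ le_rfl 1 3 (Multiset.pairwise_sort _ _) ?_ ?_ ?_ ?_ ?_
    · simpa only [hmem] using h.no_consecutive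
    · simpa only [hmem, hcount] using h.odd_not_repeated
    · intro i u v w hu hv hw he hc
      rw [hcount] at hc
      have := h.distance_two i u v w hu hv hw he hc
      have hs := (Multiset.pairwise_sort p.parts (· ≤ ·))
      obtain ⟨hi, rfl⟩ := List.getElem?_eq_some_iff.mp hu
      obtain ⟨hj, rfl⟩ := List.getElem?_eq_some_iff.mp hw
      have hle := List.pairwise_iff_getElem.mp hs i (i + 2) hi hj (by omega)
      rw [abs_of_nonpos (by omega)] at this
      omega
    · intro x hx
      exact p.parts_pos ((hmem x).mp hx)
    · intro x hx
      rw [hcount] at hx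
      have hm : x ∈ p.parts := Multiset.count_pos.mp (by omega)
      have h0 := p.parts_pos hm
      have h1 : x ≠ 1 := by
        rintro rfl
        have := h.odd_not_repeated 1 hm odd_one
        omega
      have h2 : x ≠ 2 := by
        rintro rfl
        have := h.no_two_two
        omega
      omega
  · intro h
    have hb := h.count_of_one_lt
    simp only [hcount] at hb
    refine ⟨?_, ?_, ?_, ?_⟩
    · simpa only [hmem] using h.succ_notMem
    · intro x hx ho
      by_contra hne
      have h0 := Multiset.count_pos.mpr hx
      exact Nat.not_even_iff_odd.mpr ho (hb x (by omega)).1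
    · intro i u v w hu hv hw he hc
      have := h.distance_two i u v w hu hv hw (by rwa [hcount])
      rw [abs_of_nonpos (by omega)]
      omega
    · by_contra hc
      have := (hb 2 (by omega)).2
      omega

/-- The lists that are built from single parts `≥ c` and repeated parts `≥ d`. -/
def krSet (c d : ℕ) : Set (List ℕ) := {l | KRList c d l}

/-- The generating function, by the sum, of the lists of length `m` in `S`. -/
noncomputable def listGF (S : Set (List ℕ)) (m : ℕ) : PowerSeries ℤ :=
  PowerSeries.mk fun n => ({l | l ∈ S ∧ l.sum = n ∧ l.length = m}.ncard : ℤ)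

/-- Sorting the parts and forgetting the order of a list are mutually inverse, since admissible
lists are already sorted. -/
theorem krOne_eq_coeff (n m : ℕ) :
    (krOne n m : ℤ) = PowerSeries.coeff n (listGF (krSet 1 3) m) := by
  rw [listGF, PowerSeries.coeff_mk, krOne, ← Nat.card_coe_set_eq]
  refine congrArg Nat.cast (Nat.card_congr
    { toFun := fun p => ⟨p.1.parts.sort (· ≤ ·), (krOne_iff p.1).mp p.2.2, ?_, ?_⟩
      invFun := fun l => ⟨⟨(l.1 : Multiset ℕ), ?_, ?_⟩, ?_, ?_⟩
      left_inv := ?_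
      right_inv := ?_ })
  · rw [← Multiset.sum_coe, Multiset.sort_eq, p.1.parts_sum]
  · rw [Multiset.length_sort, p.2.1]
  · intro i hi
    have := l.2.1.lower_bound i (by simpa using hi)
    omega
  · simpa using l.2.2.1
  · simpa using l.2.2.2
  · rw [krOne_iff]
    change KRList 1 3 ((l.1 : Multiset ℕ).sort (· ≤ ·))
    rw [Multiset.coe_sort, List.mergeSort_eq_self _ (by simpa using l.2.1.pairwise)]
    exact l.2.1
  · rintro ⟨p, hp⟩
    refine Subtype.ext (Nat.Partition.ext ?_)
    simp
  · rintro ⟨l, hl⟩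
    refine Subtype.ext ?_
    change (l : Multiset ℕ).sort (· ≤ ·) = l
    rw [Multiset.coe_sort, List.mergeSort_eq_self _ (by simpa using hl.1.pairwise)]

/-! ### Calculus of generating functions of sets of lists -/

theorem listGF_finite (S : Set (List ℕ)) (n m : ℕ) :
    {l | l ∈ S ∧ l.sum = n ∧ l.length = m}.Finite := by
  refine (lists_finite (Set.finite_le_nat n) m).subset ?_
  rintro l ⟨-, rfl, hm⟩
  exact ⟨hm, fun x hx => List.le_sum_of_mem hx⟩

theorem listGF_union {S T : Set (List ℕ)} (h : Disjoint S T) (m : ℕ) :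
    listGF (S ∪ T) m = listGF S m + listGF T m := by
  ext n
  rw [map_add, listGF, listGF, listGF, PowerSeries.coeff_mk, PowerSeries.coeff_mk,
    PowerSeries.coeff_mk, ← Nat.cast_add, ← Set.ncard_union_eq ?_ (listGF_finite S n m)
    (listGF_finite T n m)]
  · congr 2
    ext l
    simp only [Set.mem_union, Set.mem_ofPred_eq]
    tauto
  · exact h.mono (fun l hl => hl.1) (fun l hl => hl.1)

/-- The effect on the sum is required only at length `m`, because a translation of all parts changes
the sum by an amount depending on the length. -/
theorem listGF_image {f : List ℕ → List ℕ} (hf : f.Injective) (S : Set (List ℕ)) (j k m : ℕ)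
    (hlen : ∀ l, (f l).length = l.length + j)
    (hsum : ∀ l, l.length = m → (f l).sum = l.sum + k) :
    listGF (f '' S) (m + j) = PowerSeries.X ^ k * listGF S m := by
  ext n
  rw [PowerSeries.coeff_X_pow_mul', listGF, PowerSeries.coeff_mk]
  split_ifs with hk
  · rw [listGF, PowerSeries.coeff_mk, 
      ← Set.ncard_image_of_injective {l | l ∈ S ∧ l.sum = n - k ∧ l.length = m} hf]
    congr 2
    ext l
    simp only [Set.mem_ofPred_eq, Set.mem_image]
    constructor
    · rintro ⟨⟨l, hl, rfl⟩, h1, h2⟩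
      have hm : l.length = m := by
        rw [hlen] at h2
        omega
      have := hsum l hm
      exact ⟨l, ⟨hl, by omega, hm⟩, rfl⟩
    · rintro ⟨l, ⟨hl, h1, h2⟩, rfl⟩
      have := hsum l h2
      have := hlen l
      exact ⟨⟨l, hl, rfl⟩, by omega, by omega⟩
  · rw [Nat.cast_eq_zero, Set.ncard_eq_zero (listGF_finite _ _ _), Set.eq_empty_iff_forall_notMem]
    rintro _ ⟨⟨l, hl, rfl⟩, h1, h2⟩
    rw [hlen] at h2
    have := hsum l (by omega)
    omega

theorem listGF_image_of_lt {f : List ℕ → List ℕ} (S : Set (List ℕ)) {j m : ℕ} (hm : m < j)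
    (hlen : ∀ l, (f l).length = l.length + j) : listGF (f '' S) m = 0 := by
  ext n
  rw [listGF, PowerSeries.coeff_mk, map_zero, Nat.cast_eq_zero,
    Set.ncard_eq_zero (listGF_finite _ _ _), Set.eq_empty_iff_forall_notMem]
  rintro _ ⟨⟨l, hl, rfl⟩, h1, h2⟩
  rw [hlen] at h2
  omega

theorem listGF_zero {S : Set (List ℕ)} (hS : [] ∈ S) : listGF S 0 = 1 := by
  ext n
  rw [listGF, PowerSeries.coeff_mk, PowerSeries.coeff_one]
  split_ifs with hn
  · subst hn
    rw [Nat.cast_eq_one, Set.ncard_eq_one]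
    refine ⟨[], ?_⟩
    ext l
    simp only [Set.mem_ofPred_eq, List.length_eq_zero_iff, Set.mem_singleton_iff]
    constructor
    · exact fun h => h.2.2
    · rintro rfl
      exact ⟨hS, rfl, rfl⟩
  · rw [Nat.cast_eq_zero, Set.ncard_eq_zero (listGF_finite _ _ _), Set.eq_empty_iff_forall_notMem]
    rintro l ⟨-, h1, h2⟩
    rw [List.length_eq_zero_iff] at h2
    subst h2
    exact hn (by simpa using h1.symm)

/-! ### Decomposition by the smallest part and recurrences -/

theorem krList_iff {c d : ℕ} {l : List ℕ} : KRList c d l ↔ l = [] ∨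
    (∃ a l', l = a :: l' ∧ c ≤ a ∧ KRList (a + 2) (a + 4) l') ∨
    ∃ a l', l = a :: a :: l' ∧ d ≤ a ∧ Even a ∧ KRList (a + 4) (a + 4) l' := by
  constructor
  · rintro (_ | ⟨hc, h⟩ | ⟨hd, he, h⟩)
    · exact .inl rfl
    · exact .inr (.inl ⟨_, _, rfl, hc, h⟩)
    · exact .inr (.inr ⟨_, _, rfl, hd, he, h⟩)
  · rintro (rfl | ⟨a, l', rfl, hc, h⟩ | ⟨a, l', rfl, hd, he, h⟩)
    · exact .nil c d
    · exact .single hc h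
    · exact .double hd he h

theorem KRList.map_add_two {c d : ℕ} {l : List ℕ} (h : KRList c d l) :
    KRList (c + 2) (d + 2) (l.map (· + 2)) := by
  induction h with
  | nil => exact .nil _ _
  | single hc _ ih => exact .single (Nat.add_le_add_right hc 2) ih
  | @double c d a l hd he _ ih =>
    refine .double (Nat.add_le_add_right hd 2) (by simpa [Nat.even_add] using he) ?_
    rwa [show a + 2 + 4 = a + 4 + 2 by ring]

theorem KRList.exists_map_add_two {c' d' : ℕ} {l : List ℕ} (h : KRList c' d' l) :
    ∀ c d, c' = c + 2 → d' = d + 2 → ∃ l', KRList c d l' ∧ l'.map (· + 2) = l := by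
  induction h with
  | nil => exact fun c d _ _ => ⟨[], .nil _ _, rfl⟩
  | @single c' d' a l hc _ ih =>
    rintro c d rfl rfl
    obtain ⟨b, rfl⟩ : ∃ b, a = b + 2 := ⟨a - 2, by omega⟩
    obtain ⟨l', hl', rfl⟩ := ih (b + 2) (b + 4) rfl (by ring)
    exact ⟨b :: l', .single (by omega) hl', rfl⟩
  | @double c' d' a l hd he _ ih =>
    rintro c d rfl rfl
    obtain ⟨b, rfl⟩ : ∃ b, a = b + 2 := ⟨a - 2, by omega⟩
    obtain ⟨l', hl', rfl⟩ := ih (b + 4) (b + 4) (by ring) (by ring)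
    exact ⟨b :: b :: l', .double (by omega) (by simpa [Nat.even_add] using he) hl', rfl⟩

/-- All conditions on a list are gaps and parities, both invariant under translation by 2;
translation by 1 would destroy the evenness of repeated parts. -/
theorem krSet_add_two (c d : ℕ) :
    krSet (c + 2) (d + 2) = (fun l : List ℕ => l.map (· + 2)) '' krSet c d := by
  ext l
  constructor
  · exact fun h => h.exists_map_add_two c d rfl rfl
  · rintro ⟨l', h, rfl⟩
    exact h.map_add_two

theorem listGF_krSet_add_two (c d m : ℕ) :
    listGF (krSet (c + 2) (d + 2)) m = PowerSeries.X ^ (2 * m) * listGF (krSet c d) m := by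
  rw [krSet_add_two]
  refine listGF_image (List.map_injective_iff.mpr (add_left_injective 2)) _ 0 _ m (by simp) ?_
  rintro l rfl
  simp [List.sum_map_add, mul_comm]

/-- Split by whether 1 occurs. In the second set the bound 3 on repeated parts may be raised to 4,
since repeated parts are even. -/
theorem krSet_one_three : krSet 1 3 = (1 :: ·) '' krSet 3 5 ∪ krSet 2 4 := by
  ext l
  simp only [krSet, Set.mem_union, Set.mem_image, Set.mem_ofPred_eq]
  rw [krList_iff (c := 1), krList_iff (c := 2)]
  constructor
  · rintro (rfl | ⟨a, l', rfl, ha, h⟩ | ⟨a, l', rfl, ha, he, h⟩)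
    · exact .inr (.inl rfl)
    · rcases Nat.eq_or_lt_of_le ha with rfl | ha
      · exact .inl ⟨l', h, rfl⟩
      · exact .inr (.inr (.inl ⟨a, l', rfl, ha, h⟩))
    · refine .inr (.inr (.inr ⟨a, l', rfl, ?_, he, h⟩))
      rcases he with ⟨b, rfl⟩
      omega
  · rintro (⟨l', h, rfl⟩ | rfl | ⟨a, l', rfl, ha, h⟩ | ⟨a, l', rfl, ha, he, h⟩)
    · exact .inr (.inl ⟨1, l', rfl, le_rfl, h⟩)
    · exact .inl rfl
    · exact .inr (.inl ⟨a, l', rfl, by omega, h⟩)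
    · exact .inr (.inr ⟨a, l', rfl, by omega, he, h⟩)

/-- Split by whether the list starts with a single 2. The remainder `krSet 3 4` is the translate of
`krSet 1 2`, which is how the latter enters the system. -/
theorem krSet_two_four : krSet 2 4 = (2 :: ·) '' krSet 4 6 ∪ krSet 3 4 := by
  ext l
  simp only [krSet, Set.mem_union, Set.mem_image, Set.mem_ofPred_eq]
  rw [krList_iff (c := 2), krList_iff (c := 3)]
  constructor
  · rintro (rfl | ⟨a, l', rfl, ha, h⟩ | h)
    · exact .inr (.inl rfl)
    · rcases Nat.eq_or_lt_of_le ha with rfl | ha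
      · exact .inl ⟨l', h, rfl⟩
      · exact .inr (.inr (.inl ⟨a, l', rfl, ha, h⟩))
    · exact .inr (.inr (.inr h))
  · rintro (⟨l', h, rfl⟩ | rfl | ⟨a, l', rfl, ha, h⟩ | h)
    · exact .inr (.inl ⟨2, l', rfl, le_rfl, h⟩)
    · exact .inl rfl
    · exact .inr (.inl ⟨a, l', rfl, by omega, h⟩)
    · exact .inr (.inr h)

theorem krSet_two_two : krSet 2 2 = (fun l => 2 :: 2 :: l) '' krSet 6 6 ∪ krSet 2 4 := by
  ext l
  simp only [krSet, Set.mem_union, Set.mem_image, Set.mem_ofPred_eq]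
  rw [krList_iff (d := 2), krList_iff (d := 4)]
  constructor
  · rintro (rfl | h | ⟨a, l', rfl, ha, he, h⟩)
    · exact .inr (.inl rfl)
    · exact .inr (.inr (.inl h))
    · rcases Nat.eq_or_lt_of_le ha with rfl | ha
      · exact .inl ⟨l', h, rfl⟩
      · refine .inr (.inr (.inr ⟨a, l', rfl, ?_, he, h⟩))
        rcases he with ⟨b, rfl⟩
        omega
  · rintro (⟨l', h, rfl⟩ | rfl | h | ⟨a, l', rfl, ha, he, h⟩)
    · exact .inr (.inr ⟨2, l', rfl, le_rfl, even_two, h⟩)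
    · exact .inl rfl
    · exact .inr (.inl h)
    · exact .inr (.inr ⟨a, l', rfl, by omega, he, h⟩)

theorem krSet_one_two : krSet 1 2 = (fun l => 2 :: 2 :: l) '' krSet 6 6 ∪ krSet 1 3 := by
  ext l
  simp only [krSet, Set.mem_union, Set.mem_image, Set.mem_ofPred_eq]
  rw [krList_iff (d := 2), krList_iff (d := 3)]
  constructor
  · rintro (rfl | h | ⟨a, l', rfl, ha, he, h⟩)
    · exact .inr (.inl rfl)
    · exact .inr (.inr (.inl h))
    · rcases Nat.eq_or_lt_of_le ha with rfl | ha
      · exact .inl ⟨l', h, rfl⟩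
      · exact .inr (.inr (.inr ⟨a, l', rfl, ha, he, h⟩))
  · rintro (⟨l', h, rfl⟩ | rfl | h | ⟨a, l', rfl, ha, he, h⟩)
    · exact .inr (.inr ⟨2, l', rfl, le_rfl, even_two, h⟩)
    · exact .inl rfl
    · exact .inr (.inl h)
    · exact .inr (.inr ⟨a, l', rfl, by omega, he, h⟩)

theorem listGF_cons (a : ℕ) (S : Set (List ℕ)) (m : ℕ) :
    listGF ((a :: ·) '' S) (m + 1) = PowerSeries.X ^ a * listGF S m :=
  listGF_image List.cons_injective _ 1 _ m (by simp) (by simp [add_comm])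

theorem listGF_cons_cons (a : ℕ) (S : Set (List ℕ)) (m : ℕ) :
    listGF ((fun l => a :: a :: l) '' S) (m + 2) = PowerSeries.X ^ (2 * a) * listGF S m :=
  listGF_image (fun l l' h => by simpa using h) _ 2 _ m (by simp) (fun l _ => by simp; ring)

theorem disjoint_cons_krSet {a c d : ℕ} (h : a < min c d) (S : Set (List ℕ)) :
    Disjoint ((a :: ·) '' S) (krSet c d) := by
  refine Set.disjoint_left.mpr ?_
  rintro _ ⟨l, -, rfl⟩ (hl : KRList c d (a :: l))
  have := hl.lower_bound a (by simp)
  omega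

theorem disjoint_cons_cons_krSet {a c d : ℕ} (h : a < min d (c + 2)) (S : Set (List ℕ)) :
    Disjoint ((fun l => a :: a :: l) '' S) (krSet c d) := by
  refine Set.disjoint_left.mpr ?_
  rintro _ ⟨l, -, rfl⟩ (hl : KRList c d (a :: a :: l))
  have := (hl.count_of_one_lt a (by simp)).2
  omega

theorem listGF_krSet_zero (c d : ℕ) : listGF (krSet c d) 0 = 1 := listGF_zero (KRList.nil c d)

theorem listGF_one_three_succ (m : ℕ) : listGF (krSet 1 3) (m + 1) =
    PowerSeries.X ^ (2 * m + 1) * listGF (krSet 1 3) m + listGF (krSet 2 4) (m + 1) := by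
  conv_lhs => rw [krSet_one_three, listGF_union (disjoint_cons_krSet (by norm_num) _), listGF_cons,
    listGF_krSet_add_two 1 3]
  ring

theorem listGF_two_four_succ (m : ℕ) : listGF (krSet 2 4) (m + 1) =
    PowerSeries.X ^ (2 * m + 2) * listGF (krSet 2 4) m +
      PowerSeries.X ^ (2 * m + 2) * listGF (krSet 1 2) (m + 1) := by
  conv_lhs => rw [krSet_two_four, listGF_union (disjoint_cons_krSet (by norm_num) _), listGF_cons,
    listGF_krSet_add_two 2 4, listGF_krSet_add_two 1 2]
  ring

theorem listGF_six_six (m : ℕ) :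
    listGF (krSet 6 6) m = PowerSeries.X ^ (4 * m) * listGF (krSet 2 2) m := by
  rw [listGF_krSet_add_two 4 4, listGF_krSet_add_two 2 2]
  ring

theorem listGF_two_two (m : ℕ) : listGF (krSet 2 2) (m + 2) =
    PowerSeries.X ^ (4 * m + 4) * listGF (krSet 2 2) m + listGF (krSet 2 4) (m + 2) := by
  conv_lhs => rw [krSet_two_two, listGF_union (disjoint_cons_cons_krSet (by norm_num) _),
    listGF_cons_cons, listGF_six_six]
  ring

theorem listGF_one_two (m : ℕ) : listGF (krSet 1 2) (m + 2) =
    PowerSeries.X ^ (4 * m + 4) * listGF (krSet 2 2) m + listGF (krSet 1 3) (m + 2) := by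
  conv_lhs => rw [krSet_one_two, listGF_union (disjoint_cons_cons_krSet (by norm_num) _),
    listGF_cons_cons, listGF_six_six]
  ring

/-- Length one leaves no room for a repeated part; this is the initial case missing from
`listGF_two_two`. -/
theorem listGF_two_two_one : listGF (krSet 2 2) 1 = listGF (krSet 2 4) 1 := by
  conv_lhs => rw [krSet_two_two, listGF_union (disjoint_cons_cons_krSet (by norm_num) _),
    listGF_image_of_lt (j := 2) _ (by norm_num) (by simp), zero_add]

theorem listGF_one_two_one : listGF (krSet 1 2) 1 = listGF (krSet 1 3) 1 := by
  conv_lhs => rw [krSet_one_two, listGF_union (disjoint_cons_cons_krSet (by norm_num) _),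
    listGF_image_of_lt (j := 2) _ (by norm_num) (by simp), zero_add]

/-! ### A pair of `q`-difference equations -/

/-- Formal power series in `q`. -/
abbrev QSeries : Type := PowerSeries ℤ

/-- The square of the variable `q`. -/
noncomputable def qsq : QSeries := PowerSeries.X ^ 2

theorem one_sub_qsq_pow_mul_inv (n : ℕ) :
    (1 - qsq ^ (n + 1)) * PowerSeries.invOfUnit (1 - qsq ^ (n + 1)) 1 = 1 := by
  refine PowerSeries.mul_invOfUnit _ _ ?_
  simp [qsq]

theorem one_sub_qsq_pow_ne_zero (n : ℕ) : (1 - qsq ^ (n + 1) : QSeries) ≠ 0 :=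
  left_ne_zero_of_mul_eq_one (one_sub_qsq_pow_mul_inv n)

/-- Power series in `s` whose coefficients are polynomials in `v` over `ℤ⟦q⟧`. -/
abbrev SVSeries : Type := PowerSeries (Polynomial QSeries)

open PowerSeries in
/-- The coefficients of `s ^ n` in the two generating functions of the sequences of multiplicities
at most two, by the number of parts and the number of pairs, with or without an unpaired part
before the first one. -/
noncomputable def pairedCoeff : ℕ → Polynomial QSeries × Polynomial QSeries
  | 0 => (1, 1)
  | 1 =>
    let a := Polynomial.C (invOfUnit (1 - qsq ^ (0 + 1)) 1) * Polynomial.C (qsq ^ 1)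
    (a, Polynomial.C (qsq ^ 1) * (a + Polynomial.X))
  | n + 2 =>
    let a := Polynomial.C (invOfUnit (1 - qsq ^ (n + 1 + 1)) 1) * (Polynomial.C (qsq ^ (n + 2)) *
      (Polynomial.X * (pairedCoeff n).1 + (pairedCoeff (n + 1)).2))
    (a, Polynomial.C (qsq ^ (n + 2)) *
      (a + Polynomial.X * (pairedCoeff (n + 1)).1 + Polynomial.X * (pairedCoeff n).2))

noncomputable def pairedZero : SVSeries := PowerSeries.mk fun n => (pairedCoeff n).1

noncomputable def pairedOne : SVSeries := PowerSeries.mk fun n => (pairedCoeff n).2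

/-- The substitution `s ↦ s q²`. -/
noncomputable def shift {R : Type*} [CommRing R] [Algebra QSeries R] :
    PowerSeries R →+* PowerSeries R :=
  PowerSeries.rescale (algebraMap QSeries R qsq)

/-- The product `s q²`. -/
noncomputable def sMulQ (R : Type*) [CommRing R] [Algebra QSeries R] : PowerSeries R :=
  PowerSeries.C (algebraMap QSeries R qsq) * PowerSeries.X

noncomputable def qC (R : Type*) [CommRing R] [Algebra QSeries R] : PowerSeries R :=
  PowerSeries.C (algebraMap QSeries R qsq)

section
variable {R : Type*} [CommRing R] [Algebra QSeries R]

theorem coeff_shift (n : ℕ) (f : PowerSeries R) :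
    PowerSeries.coeff n (shift f) = algebraMap QSeries R qsq ^ n * PowerSeries.coeff n f := by
  simp [shift, PowerSeries.coeff_rescale]

theorem shift_C (a : R) : shift (PowerSeries.C a) = PowerSeries.C a := by
  ext n
  rw [coeff_shift]
  rcases n with _ | n <;> simp [PowerSeries.coeff_C]

theorem shift_X : shift (PowerSeries.X : PowerSeries R) = sMulQ R := by
  simp [shift, sMulQ, PowerSeries.rescale_X]

theorem shift_qC : shift (qC R) = qC R := shift_C _

theorem shift_sMulQ : shift (sMulQ R) = qC R * sMulQ R := by
  conv_lhs => rw [sMulQ, map_mul, shift_C, shift_X]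
  rfl

theorem coeff_zero_sMulQ_mul (f : PowerSeries R) : PowerSeries.coeff 0 (sMulQ R * f) = 0 := by
  simp [sMulQ]

theorem coeff_succ_sMulQ_mul_shift (n : ℕ) (f : PowerSeries R) :
    PowerSeries.coeff (n + 1) (sMulQ R * shift f) =
      algebraMap QSeries R qsq ^ (n + 1) * PowerSeries.coeff n f := by
  rw [sMulQ, mul_assoc, PowerSeries.coeff_C_mul, PowerSeries.coeff_succ_X_mul, coeff_shift]
  ring

theorem coeff_add_two_sMulQ_sq_mul_shift (n : ℕ) (f : PowerSeries R) :
    PowerSeries.coeff (n + 2) (sMulQ R ^ 2 * shift f) =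
      algebraMap QSeries R qsq ^ (n + 2) * PowerSeries.coeff n f := by
  rw [sMulQ, mul_pow, ← map_pow, mul_assoc, PowerSeries.coeff_C_mul, PowerSeries.coeff_X_pow_mul,
    coeff_shift]
  ring

theorem coeff_zero_sMulQ_sq_mul (f : PowerSeries R) : PowerSeries.coeff 0 (sMulQ R ^ 2 * f) = 0 := by
  simp [sMulQ]

theorem coeff_one_sMulQ_sq_mul (f : PowerSeries R) : PowerSeries.coeff 1 (sMulQ R ^ 2 * f) = 0 := by
  rw [sMulQ, mul_pow, ← map_pow, mul_assoc, PowerSeries.coeff_C_mul, PowerSeries.coeff_X_pow_mul']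
  simp

end

/-- The system satisfied by the generating functions of sequences of multiplicities at most two
when a pair is counted with weight `w`. -/
structure PairedSystem {R : Type*} [CommRing R] [Algebra QSeries R] (w : R)
    (f g : PowerSeries R) : Prop where
  left : f = (1 + PowerSeries.C w * sMulQ R ^ 2) * shift f + sMulQ R * shift g
  right : g = (1 + PowerSeries.C w * sMulQ R) * shift f + PowerSeries.C w * sMulQ R ^ 2 * shift g

/-- The recursion for `pairedCoeff` is this system solved coefficient by coefficient.
Combinatorially, the first equation lists the multiplicities 0, 2, 1 of the smallest value when no
part is waiting for a partner. The second does so for 0, 1, 2 when one part is waiting; with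
multiplicity 2, one copy completes a pair and the other waits in turn. -/
theorem pairedSystem_paired :
    PairedSystem (Polynomial.X : Polynomial QSeries) pairedZero pairedOne := by
  have hC (f g : SVSeries) (n : ℕ) : PowerSeries.coeff n (PowerSeries.C Polynomial.X * f * g) =
      Polynomial.X * PowerSeries.coeff n (f * g) := by
    rw [mul_assoc, PowerSeries.coeff_C_mul]
  have key (n : ℕ) : (1 - Polynomial.C (qsq ^ (n + 1))) *
      Polynomial.C (PowerSeries.invOfUnit (1 - qsq ^ (n + 1)) 1) = 1 := by
    rw [← Polynomial.C_1, ← Polynomial.C_sub, ← Polynomial.C_mul, one_sub_qsq_pow_mul_inv]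
  constructor
  · ext1 n
    rw [add_mul, one_mul, map_add, map_add, hC, coeff_shift]
    rcases n with _ | _ | n
    · simp [pairedZero, pairedCoeff, sMulQ]
    · rw [coeff_one_sMulQ_sq_mul, coeff_succ_sMulQ_mul_shift]
      simp only [pairedZero, pairedOne, pairedCoeff, PowerSeries.coeff_mk,
        Polynomial.algebraMap_eq, ← Polynomial.C_pow]
      linear_combination Polynomial.C (qsq ^ 1) * key 0
    · rw [coeff_add_two_sMulQ_sq_mul_shift, coeff_succ_sMulQ_mul_shift]
      simp only [pairedZero, pairedOne, pairedCoeff, PowerSeries.coeff_mk,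
        Polynomial.algebraMap_eq, ← Polynomial.C_pow]
      linear_combination Polynomial.C (qsq ^ (n + 2)) *
        (Polynomial.X * (pairedCoeff n).1 + (pairedCoeff (n + 1)).2) * key (n + 1)
  · ext1 n
    rw [add_mul, one_mul, map_add, map_add, hC, hC, coeff_shift]
    rcases n with _ | _ | n
    · simp [pairedZero, pairedOne, pairedCoeff, sMulQ]
    · rw [coeff_one_sMulQ_sq_mul, coeff_succ_sMulQ_mul_shift]
      simp only [pairedZero, pairedOne, pairedCoeff, PowerSeries.coeff_mk,
        Polynomial.algebraMap_eq, ← Polynomial.C_pow]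
      ring
    · rw [coeff_add_two_sMulQ_sq_mul_shift, coeff_succ_sMulQ_mul_shift]
      simp only [pairedZero, pairedOne, pairedCoeff, PowerSeries.coeff_mk,
        Polynomial.algebraMap_eq, ← Polynomial.C_pow]
      ring

namespace PairedSystem
variable {R : Type*} [CommRing R] [Algebra QSeries R] {w : R}

theorem sub {f g f' g' : PowerSeries R} (h : PairedSystem w f g) (h' : PairedSystem w f' g') :
    PairedSystem w (f - f') (g - g') := by
  constructor
  · rw [map_sub, map_sub]
    linear_combination h.left - h'.left
  · rw [map_sub, map_sub]
    linear_combination h.right - h'.right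

/-- In degree `n ≥ 1` the first equation determines the coefficient of `f` up to the nonzero factor
`1 - q^(2n)`, and the second then determines that of `g`. Only the constant coefficient of `f` is
free. -/
theorem eq_zero [IsDomain R] [FaithfulSMul QSeries R] {f g : PowerSeries R}
    (h : PairedSystem w f g) (hf : PowerSeries.coeff 0 f = 0) : f = 0 ∧ g = 0 := by
  have hC (f g : PowerSeries R) (n : ℕ) : PowerSeries.coeff n (PowerSeries.C w * f * g) =
      w * PowerSeries.coeff n (f * g) := by
    rw [mul_assoc, PowerSeries.coeff_C_mul]
  have hne (n : ℕ) : (1 - algebraMap QSeries R qsq ^ (n + 1)) ≠ 0 := by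
    rw [← map_pow, ← map_one (algebraMap QSeries R), ← map_sub]
    exact (map_ne_zero_iff _ (FaithfulSMul.algebraMap_injective _ _)).mpr
      (one_sub_qsq_pow_ne_zero n)
  have hl (n : ℕ) := congrArg (PowerSeries.coeff n) h.left
  have hr (n : ℕ) := congrArg (PowerSeries.coeff n) h.right
  simp only [add_mul, one_mul, map_add, hC, coeff_shift] at hl hr
  have main (n : ℕ) : (PowerSeries.coeff n f = 0 ∧ PowerSeries.coeff n g = 0) ∧
      PowerSeries.coeff (n + 1) f = 0 ∧ PowerSeries.coeff (n + 1) g = 0 := by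
    induction n with
    | zero =>
      have h0 : PowerSeries.coeff 0 g = 0 := by
        have := hr 0
        rw [coeff_zero_sMulQ_mul, coeff_zero_sMulQ_sq_mul, hf] at this
        simpa using this
      have h1 : PowerSeries.coeff 1 f = 0 := by
        have := hl 1
        rw [coeff_one_sMulQ_sq_mul, coeff_succ_sMulQ_mul_shift, h0] at this
        refine (mul_eq_zero.mp ?_).resolve_left (hne 0)
        linear_combination this
      have h1' : PowerSeries.coeff 1 g = 0 := by
        have := hr 1
        rw [coeff_one_sMulQ_sq_mul, coeff_succ_sMulQ_mul_shift, hf, h1] at this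
        linear_combination this
      exact ⟨⟨hf, h0⟩, h1, h1'⟩
    | succ n ih =>
      obtain ⟨⟨a, b⟩, c, d⟩ := ih
      have h1 : PowerSeries.coeff (n + 2) f = 0 := by
        have := hl (n + 2)
        rw [coeff_add_two_sMulQ_sq_mul_shift, coeff_succ_sMulQ_mul_shift, a, d] at this
        refine (mul_eq_zero.mp ?_).resolve_left (hne (n + 1))
        linear_combination this
      have h2 : PowerSeries.coeff (n + 2) g = 0 := by
        have := hr (n + 2)
        rw [coeff_add_two_sMulQ_sq_mul_shift, coeff_succ_sMulQ_mul_shift, b, c, h1] at this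
        linear_combination this
      exact ⟨⟨c, d⟩, h1, h2⟩
  constructor <;> ext n
  · simpa using (main n).1.1
  · simpa using (main n).1.2

theorem ext [IsDomain R] [FaithfulSMul QSeries R] {f g f' g' : PowerSeries R}
    (h : PairedSystem w f g) (h' : PairedSystem w f' g')
    (hf : PowerSeries.coeff 0 f = PowerSeries.coeff 0 f') : f = f' ∧ g = g' := by
  have := (h.sub h').eq_zero (by rw [map_sub, hf, sub_self])
  exact ⟨sub_eq_zero.mp this.1, sub_eq_zero.mp this.2⟩

/-- The contiguity relation: a solution for the weight `w q⁶` obtained from one for `w`. -/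
theorem contiguous {f g : PowerSeries R} (h : PairedSystem w f g) :
    PairedSystem (w * algebraMap QSeries R qsq ^ 3)
      (f - PowerSeries.C w * (sMulQ R ^ 2 * shift f +
        (qC R + qC R ^ 2) * sMulQ R ^ 2 * shift (shift f) +
        sMulQ R ^ 3 * qC R ^ 2 * shift (shift g)))
      (g - PowerSeries.C w * (sMulQ R * shift f + sMulQ R ^ 2 * shift g +
        (sMulQ R ^ 2 * qC R ^ 2 - sMulQ R * qC R ^ 3) * shift (shift f))) := by
  have a1 := congrArg shift h.left
  have b1 := congrArg shift h.right
  simp only [map_add, map_mul, map_pow, map_one, shift_C, shift_sMulQ] at a1 b1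
  have a2 := congrArg shift a1
  have b2 := congrArg shift b1
  simp only [map_add, map_mul, map_pow, map_one, shift_C, shift_sMulQ, shift_qC] at a2 b2
  have a0 := h.left
  have b0 := h.right
  have hw : PowerSeries.C (w * algebraMap QSeries R qsq ^ 3) = PowerSeries.C w * qC R ^ 3 := by
    rw [map_mul, map_pow, qC]
  -- Iterating the two equations expresses every shift through the threefold shifts `f3`, `g3`, so
  -- that both claims become polynomial identities.
  constructor <;> rw [hw] <;>
    simp only [map_add, map_sub, map_mul, map_pow, shift_C, shift_sMulQ, shift_qC] <;>
    generalize shift (shift (shift f)) = f3 at * <;>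
    generalize shift (shift (shift g)) = g3 at * <;>
    generalize shift (shift f) = f2 at * <;>
    generalize shift (shift g) = g2 at * <;>
    generalize shift f = f1 at * <;>
    generalize shift g = g1 at * <;>
    first
    | rw [a0, a1, b1, a2, b2]; ring
    | rw [b0, a1, b1, a2, b2]; ring

end PairedSystem

/-- The coefficient of `v ^ p`. -/
noncomputable def vCoeff (p : ℕ) : SVSeries →+ PowerSeries QSeries where
  toFun f := PowerSeries.mk fun n => (PowerSeries.coeff n f).coeff p
  map_zero' := by ext1 n; simp
  map_add' f g := by ext1 n; simp

theorem coeff_vCoeff (p n : ℕ) (f : SVSeries) :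
    PowerSeries.coeff n (vCoeff p f) = (PowerSeries.coeff n f).coeff p := by
  simp [vCoeff]

theorem vCoeff_map_mul (p : ℕ) (g : PowerSeries QSeries) (f : SVSeries) :
    vCoeff p (PowerSeries.map Polynomial.C g * f) = g * vCoeff p f := by
  ext1 n
  rw [coeff_vCoeff, PowerSeries.coeff_mul, PowerSeries.coeff_mul, Polynomial.finsetSum_coeff]
  simp [coeff_vCoeff]

theorem vCoeff_shift (p : ℕ) (f : SVSeries) : vCoeff p (shift f) = shift (vCoeff p f) := by
  ext1 n
  rw [coeff_vCoeff, coeff_shift, coeff_shift, coeff_vCoeff, Polynomial.algebraMap_eq,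
    ← Polynomial.C_pow, Polynomial.coeff_C_mul]
  rfl

theorem vCoeff_succ_C_X_mul (p : ℕ) (f : SVSeries) :
    vCoeff (p + 1) (PowerSeries.C Polynomial.X * f) = vCoeff p f := by
  ext1 n
  rw [coeff_vCoeff, coeff_vCoeff, PowerSeries.coeff_C_mul, Polynomial.coeff_X_mul]

theorem vCoeff_zero_C_X_mul (f : SVSeries) :
    vCoeff 0 (PowerSeries.C Polynomial.X * f) = 0 := by
  ext1 n
  rw [coeff_vCoeff, PowerSeries.coeff_C_mul, Polynomial.coeff_X_mul_zero, map_zero]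

/-- The substitution `v ↦ v q⁶`. -/
noncomputable def vShift : SVSeries →+* SVSeries :=
  PowerSeries.map (Polynomial.compRingHom (Polynomial.C (qsq ^ 3) * Polynomial.X))

theorem vCoeff_vShift (p : ℕ) (f : SVSeries) :
    vCoeff p (vShift f) = PowerSeries.C (qsq ^ (3 * p)) * vCoeff p f := by
  ext1 n
  rw [coeff_vCoeff, vShift, PowerSeries.coeff_map, Polynomial.coe_compRingHom_apply,
    Polynomial.comp_C_mul_X_coeff, PowerSeries.coeff_C_mul, coeff_vCoeff, pow_mul, mul_comm]

/-! ### The recursion in the number of pairs -/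

theorem map_shift {R R' : Type*} [CommRing R] [Algebra QSeries R] [CommRing R']
    [Algebra QSeries R'] (φ : R →+* R')
    (hφ : φ (algebraMap QSeries R qsq) = algebraMap QSeries R' qsq) (f : PowerSeries R) :
    PowerSeries.map φ (shift f) = shift (PowerSeries.map φ f) := by
  ext1 n
  rw [PowerSeries.coeff_map, coeff_shift, coeff_shift, PowerSeries.coeff_map, map_mul, map_pow, hφ]

theorem PairedSystem.map {R R' : Type*} [CommRing R] [Algebra QSeries R] [CommRing R']
    [Algebra QSeries R'] (φ : R →+* R')
    (hφ : φ (algebraMap QSeries R qsq) = algebraMap QSeries R' qsq) {w : R} {f g : PowerSeries R}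
    (h : PairedSystem w f g) :
    PairedSystem (φ w) (PowerSeries.map φ f) (PowerSeries.map φ g) := by
  have a := congrArg (PowerSeries.map φ) h.left
  have b := congrArg (PowerSeries.map φ) h.right
  simp only [map_add, map_mul, map_pow, map_one, map_shift φ hφ, sMulQ, PowerSeries.map_C,
    PowerSeries.map_X, hφ] at a b
  exact ⟨a, b⟩

/-- Both sides solve the system of weight `v q^6`, the left by substitution and the right by
contiguity, with the same constant coefficient; solutions are unique. -/
theorem vShift_paired :
    vShift pairedZero = pairedZero - PowerSeries.C Polynomial.X *
      (sMulQ _ ^ 2 * shift pairedZero +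
        (qC _ + qC _ ^ 2) * sMulQ _ ^ 2 * shift (shift pairedZero) +
        sMulQ _ ^ 3 * qC _ ^ 2 * shift (shift pairedOne)) ∧
    vShift pairedOne = pairedOne - PowerSeries.C Polynomial.X *
      (sMulQ _ * shift pairedZero + sMulQ _ ^ 2 * shift pairedOne +
        (sMulQ _ ^ 2 * qC _ ^ 2 - sMulQ _ * qC _ ^ 3) * shift (shift pairedZero)) := by
  have h := pairedSystem_paired.map
    (Polynomial.compRingHom (Polynomial.C (qsq ^ 3) * Polynomial.X)) (by simp)
  have hw : Polynomial.compRingHom (Polynomial.C (qsq ^ 3) * Polynomial.X) Polynomial.X =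
      Polynomial.X * algebraMap QSeries (Polynomial QSeries) qsq ^ 3 := by
    simp [mul_comm]
  rw [hw] at h
  refine h.ext pairedSystem_paired.contiguous ?_
  rw [map_sub, PowerSeries.coeff_C_mul]
  simp [pairedZero, pairedCoeff, sMulQ]

/-- The part with `p` pairs of the first generating function. -/
noncomputable def withPairs (p : ℕ) : PowerSeries QSeries := vCoeff p pairedZero

/-- The part with `p` pairs of the second generating function. -/
noncomputable def withPairs' (p : ℕ) : PowerSeries QSeries := vCoeff p pairedOne

theorem sMulQ_polynomial :
    sMulQ (Polynomial QSeries) = PowerSeries.map Polynomial.C (sMulQ QSeries) := by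
  simp [sMulQ]

theorem qC_polynomial :
    qC (Polynomial QSeries) = PowerSeries.map Polynomial.C (qC QSeries) := by
  simp [qC]

theorem withPairs_zero : withPairs 0 = shift (withPairs 0) + sMulQ _ * shift (withPairs' 0) := by
  have h := congrArg (vCoeff 0) pairedSystem_paired.left
  rw [add_mul, one_mul, mul_assoc, map_add, map_add, vCoeff_zero_C_X_mul, sMulQ_polynomial,
    vCoeff_map_mul, vCoeff_shift, vCoeff_shift, add_zero] at h
  exact h

/-- If no pair may be formed, a waiting part forces the next value to be absent. -/
theorem withPairs'_zero : withPairs' 0 = shift (withPairs 0) := by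
  have h := congrArg (vCoeff 0) pairedSystem_paired.right
  rw [add_mul, one_mul, mul_assoc, mul_assoc, map_add, map_add, vCoeff_zero_C_X_mul,
    vCoeff_zero_C_X_mul, vCoeff_shift, add_zero, add_zero] at h
  exact h

/-- The coefficient of `v^(p+1)` in the contiguity relation: `v ↦ v q^6` multiplies it by
`q^(6(p+1))`, while the explicit factor `v` of the correction lowers the index to `p`. -/
theorem withPairs_succ (p : ℕ) :
    (1 - PowerSeries.C (qsq ^ (3 * (p + 1)))) * withPairs (p + 1) =
      sMulQ _ ^ 2 * shift (withPairs p) +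
        (qC _ + qC _ ^ 2) * sMulQ _ ^ 2 * shift (shift (withPairs p)) +
        sMulQ _ ^ 3 * qC _ ^ 2 * shift (shift (withPairs' p)) := by
  have h := congrArg (vCoeff (p + 1)) vShift_paired.1
  simp only [vCoeff_vShift, map_sub, vCoeff_succ_C_X_mul, sMulQ_polynomial, qC_polynomial,
    ← map_pow, ← map_add, ← map_mul] at h
  simp only [map_add (vCoeff p), vCoeff_map_mul, vCoeff_shift] at h
  change _ * withPairs (p + 1) = withPairs (p + 1) - (_ * shift (withPairs p) +
    _ * shift (shift (withPairs p)) + _ * shift (shift (withPairs' p))) at h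
  linear_combination -h

theorem withPairs'_succ (p : ℕ) :
    (1 - PowerSeries.C (qsq ^ (3 * (p + 1)))) * withPairs' (p + 1) =
      sMulQ _ * shift (withPairs p) + sMulQ _ ^ 2 * shift (withPairs' p) +
        (sMulQ _ ^ 2 * qC _ ^ 2 - sMulQ _ * qC _ ^ 3) * shift (shift (withPairs p)) := by
  have h := congrArg (vCoeff (p + 1)) vShift_paired.2
  simp only [vCoeff_vShift, map_sub (vCoeff _), vCoeff_succ_C_X_mul, sMulQ_polynomial,
    qC_polynomial, ← map_pow, ← map_sub, ← map_mul] at h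
  simp only [map_add (vCoeff p), vCoeff_map_mul, vCoeff_shift] at h
  change _ * withPairs' (p + 1) = withPairs' (p + 1) - (_ * shift (withPairs p) +
    _ * shift (withPairs' p) + _ * shift (shift (withPairs p))) at h
  linear_combination -h

/-- The product `(q⁶; q⁶)_p`. -/
noncomputable def cubeProd (p : ℕ) : QSeries := ∏ k ∈ Finset.range p, (1 - qsq ^ (3 * (k + 1)))

/-- Two sequences of series with the recursion of the base partitions are proportional to the parts
with `p` pairs. -/
theorem eq_cubeProd_mul_withPairs (U V Z : ℕ → PowerSeries QSeries)
    (hZ : Z 0 = 0) (hZU : ∀ p, Z (p + 1) = U p) (hU0 : U 0 = withPairs 0) (hV0 : V 0 = withPairs 0)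
    (hU : ∀ p, U (p + 1) = sMulQ _ ^ 2 * (shift (U p) + qC _ * shift (V p) +
      qC _ ^ 2 * shift (shift (U p))) +
      sMulQ _ ^ 5 * qC _ ^ 8 * shift (shift (shift (shift (Z p)))))
    (hV : ∀ p, V (p + 1) = sMulQ _ ^ 2 * (qC _ * shift (V p) + qC _ ^ 2 * shift (shift (U p)) +
      qC _ ^ 3 * shift (shift (V p))) +
      sMulQ _ ^ 5 * qC _ ^ 8 * shift (shift (shift (shift (Z p)))) +
      sMulQ _ ^ 5 * qC _ ^ 13 * shift (shift (shift (shift (shift (Z p)))))) (p : ℕ) :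
    U p = PowerSeries.C (cubeProd p) * withPairs p := by
  -- The recursion for `U` involves `V`, so a formula for `V` is carried along. After a pair `[0,
  -- 1]`, the value 1 may not occur twice, which leaves the multiplicities 0 and 1 of the first
  -- equation. The subtracted term removes `1, 3, 3` (three parts of sum 7), which would complete
  -- `[0, 1]` to a block.
  suffices h : U p = PowerSeries.C (cubeProd p) * withPairs p ∧
      V p = PowerSeries.C (cubeProd p) * (shift (withPairs p) + sMulQ _ * shift (withPairs' p)) -
        sMulQ _ ^ 3 * qC _ ^ 4 * shift (shift (shift (Z p))) from h.1
  induction p with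
  | zero =>
    rw [← withPairs_zero]
    simp [hZ, hU0, hV0, cubeProd]
  | succ p ih =>
    obtain ⟨ihU, ihV⟩ := ih
    have hprod : PowerSeries.C (cubeProd (p + 1)) =
        PowerSeries.C (cubeProd p) * (1 - PowerSeries.C (qsq ^ (3 * (p + 1)))) := by
      rw [cubeProd, Finset.prod_range_succ, map_mul, map_sub, map_one, cubeProd]
    have c0 := withPairs_succ p
    have c1 := congrArg shift c0
    have d1 := congrArg shift (withPairs'_succ p)
    have u1 := congrArg shift ihU
    have v1 := congrArg shift ihV
    simp only [map_add, map_sub, map_mul, map_pow, map_one, shift_C, shift_sMulQ, shift_qC]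
      at c1 d1 u1 v1
    have u2 := congrArg shift u1
    have v2 := congrArg shift v1
    simp only [map_add, map_sub, map_mul, map_pow, shift_C, shift_sMulQ, shift_qC] at u2 v2
    have u3 := congrArg shift u2
    simp only [map_mul, shift_C] at u3
    simp only [map_pow] at c0 hprod
    constructor
    · rw [hU, hprod, u2, u1, v1]
      linear_combination (-PowerSeries.C (cubeProd p)) * c0
    · rw [hV, hprod, hZU, u3, u2, v2, v1]
      linear_combination (-PowerSeries.C (cubeProd p)) * (c1 + sMulQ QSeries * d1)

/-- The first generating function with the number of pairs forgotten. -/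
noncomputable def atMostTwice : PowerSeries QSeries :=
  PowerSeries.map (Polynomial.evalRingHom 1) pairedZero

/-- At `v = 1` the two series coincide, since whether a part is waiting no longer affects the
weight: their difference `d` satisfies `d = ((s q^2)^2 - s q^2) shift d`, hence vanishes. The first
equation then becomes the product recursion. -/
theorem atMostTwice_eq : atMostTwice = (1 + sMulQ _ + sMulQ _ ^ 2) * shift atMostTwice := by
  have h := pairedSystem_paired.map (Polynomial.evalRingHom (1 : QSeries)) (by simp)
  change PairedSystem _ atMostTwice _ at h
  generalize PowerSeries.map (Polynomial.evalRingHom (1 : QSeries)) pairedOne = g at h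
  obtain ⟨h1, h2⟩ := h
  simp only [Polynomial.coe_evalRingHom, Polynomial.eval_X, map_one] at h1 h2
  have key : atMostTwice - g = 0 := by
    have hd : atMostTwice - g = (sMulQ _ ^ 2 - sMulQ _) * shift (atMostTwice - g) := by
      rw [map_sub]
      linear_combination h1 - h2
    generalize atMostTwice - g = d at hd
    have main (n : ℕ) : PowerSeries.coeff n d = 0 ∧ PowerSeries.coeff (n + 1) d = 0 := by
      rw [sub_mul] at hd
      have hc (n : ℕ) := congrArg (PowerSeries.coeff n) hd
      simp only [map_sub] at hc
      have h0 : PowerSeries.coeff 0 d = 0 := by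
        rw [hc, coeff_zero_sMulQ_sq_mul, coeff_zero_sMulQ_mul, sub_zero]
      induction n with
      | zero =>
        refine ⟨h0, ?_⟩
        rw [hc, coeff_one_sMulQ_sq_mul, coeff_succ_sMulQ_mul_shift, h0]
        simp
      | succ n ih =>
        refine ⟨ih.2, ?_⟩
        rw [hc, coeff_add_two_sMulQ_sq_mul_shift, coeff_succ_sMulQ_mul_shift, ih.1, ih.2]
        simp
    ext1 n
    exact (main n).1
  rw [← sub_eq_zero.mp key] at h1
  linear_combination h1

/-- Setting `v = 1` sums over all numbers of pairs, and `n` parts cannot contain more than `n`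
pairs, so the degree in `v` bounds the sum. -/
theorem coeff_atMostTwice (n : ℕ) : PowerSeries.coeff n atMostTwice =
    ∑ p ∈ Finset.range (n + 1), PowerSeries.coeff n (withPairs p) := by
  have hdeg (n : ℕ) : ((pairedCoeff n).1.natDegree ≤ n ∧ (pairedCoeff n).2.natDegree ≤ n) ∧
      (pairedCoeff (n + 1)).1.natDegree ≤ n + 1 ∧ (pairedCoeff (n + 1)).2.natDegree ≤ n + 1 := by
    induction n with
    | zero =>
      simp only [pairedCoeff]
      refine ⟨by simp, ?_, ?_⟩
      · rw [← Polynomial.C_mul, Polynomial.natDegree_C]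
        exact Nat.zero_le _
      · rw [← Polynomial.C_mul]
        refine (Polynomial.natDegree_C_mul_le _ _).trans ?_
        refine (Polynomial.natDegree_add_le _ _).trans (max_le ?_ Polynomial.natDegree_X_le)
        rw [Polynomial.natDegree_C]
        exact Nat.zero_le _
    | succ n ih =>
      refine ⟨ih.2, ?_⟩
      obtain ⟨⟨a, b⟩, c, d⟩ := ih
      have hX (f : Polynomial QSeries) : (Polynomial.X * f).natDegree ≤ f.natDegree + 1 :=
        Polynomial.natDegree_mul_le.trans (by rw [Polynomial.natDegree_X, add_comm])
      have h1 : (pairedCoeff (n + 1 + 1)).1.natDegree ≤ n + 1 + 1 := by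
        rw [pairedCoeff]
        refine (Polynomial.natDegree_C_mul_le _ _).trans ?_
        refine (Polynomial.natDegree_C_mul_le _ _).trans ?_
        refine (Polynomial.natDegree_add_le _ _).trans (max_le ((hX _).trans ?_) ?_) <;> omega
      refine ⟨h1, ?_⟩
      rw [pairedCoeff]
      refine (Polynomial.natDegree_C_mul_le _ _).trans ?_
      refine (Polynomial.natDegree_add_le _ _).trans (max_le
        ((Polynomial.natDegree_add_le _ _).trans (max_le ?_ ((hX _).trans ?_)))
        ((hX _).trans ?_))
      · exact h1
      · omega
      · omega
  rw [atMostTwice, PowerSeries.coeff_map, Polynomial.coe_evalRingHom,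
    Polynomial.eval_eq_sum_range' (n := n + 1)]
  · simp [withPairs, coeff_vCoeff]
  · rw [pairedZero, PowerSeries.coeff_mk]
    exact Nat.lt_succ_of_le (hdeg n).1.1

/-! ### Generating functions of base partitions -/

/-- `1 / (q^s; q^s)_n` as a power series in `q`. -/
noncomputable def qInvPochhammer (s n : ℕ) : QSeries :=
  PowerSeries.invOfUnit (∏ k ∈ Finset.range n,
    (1 - (PowerSeries.X : QSeries) ^ s * (PowerSeries.X ^ s) ^ k)) 1

theorem prod_mul_qInvPochhammer {s : ℕ} (hs : s ≠ 0) (n : ℕ) :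
    (∏ k ∈ Finset.range n, (1 - (PowerSeries.X : QSeries) ^ s * (PowerSeries.X ^ s) ^ k)) *
      qInvPochhammer s n = 1 := by
  refine PowerSeries.mul_invOfUnit _ _ ?_
  simp [hs]

theorem qInvPochhammer_zero (s : ℕ) : qInvPochhammer s 0 = 1 := by
  have : (1 : QSeries) * PowerSeries.invOfUnit 1 1 = 1 := PowerSeries.mul_invOfUnit _ _ (by simp)
  simpa [qInvPochhammer] using this

theorem mul_qInvPochhammer_succ {s : ℕ} (hs : s ≠ 0) (n : ℕ) :
    (1 - (PowerSeries.X : QSeries) ^ (s * (n + 1))) * qInvPochhammer s (n + 1) =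
      qInvPochhammer s n := by
  have h1 := prod_mul_qInvPochhammer hs n
  have h2 := prod_mul_qInvPochhammer hs (n + 1)
  rw [Finset.prod_range_succ] at h2
  have h3 : (PowerSeries.X : QSeries) ^ (s * (n + 1)) =
      PowerSeries.X ^ s * (PowerSeries.X ^ s) ^ n := by ring
  rw [h3]
  refine mul_left_cancel₀ (left_ne_zero_of_mul_eq_one h1) ?_
  linear_combination h2 - h1

theorem cubeProd_mul_qInvPochhammer (p : ℕ) : cubeProd p * qInvPochhammer 6 p = 1 := by
  rw [← prod_mul_qInvPochhammer (s := 6) (by norm_num) p, cubeProd]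
  congr 1
  refine Finset.prod_congr rfl fun k _ => ?_
  rw [qsq]
  ring

/-- The generating function of the sequences of singletons that are greater than `m` and differ
pairwise by at least two. -/
noncomputable def singletons (m : ℕ) : PowerSeries QSeries :=
  PowerSeries.mk fun n => qsq ^ (n ^ 2 + m * n) * qInvPochhammer 2 n

theorem shift_singletons (m : ℕ) : shift (singletons m) = singletons (m + 1) := by
  ext1 n
  rw [coeff_shift]
  simp only [singletons, PowerSeries.coeff_mk, Algebra.algebraMap_self, RingHom.id_apply]
  ring

/-- Both series have constant coefficient 1 and satisfy `F = shift F + s q^2 shift (shift F)`, which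
determines the rest. -/
theorem singletons_zero : singletons 0 = withPairs 0 := by
  have h := withPairs_zero
  rw [withPairs'_zero] at h
  ext1 n
  induction n with
  | zero =>
    simp [singletons, withPairs, vCoeff, pairedZero, pairedCoeff, qInvPochhammer_zero]
  | succ n ih =>
    have hc := congrArg (PowerSeries.coeff (n + 1)) h
    rw [map_add, coeff_succ_sMulQ_mul_shift, coeff_shift, coeff_shift, ← ih] at hc
    refine mul_left_cancel₀ (one_sub_qsq_pow_ne_zero n) ?_
    have hm := mul_qInvPochhammer_succ (s := 2) (by norm_num) n
    rw [pow_mul] at hm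
    simp only [singletons, PowerSeries.coeff_mk, Algebra.algebraMap_self, RingHom.id_apply]
      at hc ⊢
    change (1 - qsq ^ (n + 1)) * _ = _ at hm
    linear_combination -hc + qsq ^ ((n + 1) ^ 2) * hm

namespace Piece

/-- The number of pairs in a piece. -/
def pairs : Piece → ℕ
  | rep _ => 1
  | con _ => 1
  | block _ => 2

end Piece

/-- The number of pairs in a sequence of pieces. -/
def pairCount (β : List Piece) : ℕ := (β.map Piece.pairs).sum

/-- The number of parts in a sequence of pieces. -/
def partCount (β : List Piece) : ℕ := (β.map fun p => p.parts.length).sum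

/-- The pieces of `β` are tightly packed after the pair `x`. -/
def PackedAfter (x : ℕ × ℕ) (β : List Piece) : Prop :=
  (∀ p ∈ β.head?, Tight x p.firstPair) ∧ β.IsChain (fun p r => Tight p.lastPair r.firstPair)

/-- The smaller part of the largest pair, if the pair `x` stands in front of `β`. -/
def lastLow (x : ℕ × ℕ) (β : List Piece) : ℕ :=
  match β.getLast? with
  | none => x.1
  | some p => p.lastPair.1

/-! ### Packed sequences and the removal of the first piece -/

theorem packedAfter_nil (x : ℕ × ℕ) : PackedAfter x [] := by simp [PackedAfter]

theorem packedAfter_cons (x : ℕ × ℕ) (a : Piece) (β : List Piece) :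
    PackedAfter x (a :: β) ↔ Tight x a.firstPair ∧ PackedAfter a.lastPair β := by
  simp [PackedAfter, List.isChain_cons]

theorem lastLow_cons (x : ℕ × ℕ) (a : Piece) (β : List Piece) :
    lastLow x (a :: β) = lastLow a.lastPair β := by
  rcases β with _ | ⟨b, β⟩
  · simp [lastLow]
  · simp only [lastLow, List.getLast?_cons_cons, List.getLast?_eq_some_getLast (List.cons_ne_nil b β)]

theorem Piece.one_le_pairs (a : Piece) : 1 ≤ a.pairs := by
  cases a <;> simp [Piece.pairs]

/-- The generating function of the base partitions that extend `β`, in which the moveable pairs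
have not yet been moved. -/
noncomputable def baseTerm (x : ℕ × ℕ) (β : List Piece) : PowerSeries QSeries :=
  PowerSeries.X ^ partCount β * PowerSeries.C (qsq ^ baseWeight β) * singletons (lastLow x β)

theorem baseTerm_cons (x : ℕ × ℕ) (a : Piece) (β : List Piece) :
    baseTerm x (a :: β) = PowerSeries.X ^ a.parts.length * PowerSeries.C (qsq ^ a.parts.sum) *
      baseTerm a.lastPair β := by
  simp only [baseTerm, partCount, baseWeight, lastLow_cons, List.map_cons, List.sum_cons, pow_add,
    map_mul]
  ring

/-- The sequences packed after `x` that have `p` pairs when `c` further pairs are added. -/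
def packedSet (x : ℕ × ℕ) (c p : ℕ) : Set (List Piece) :=
  {β | PackedAfter x β ∧ pairCount β + c = p}

theorem heads_rep (k : ℕ) : {a : Piece | Tight (k, k) a.firstPair} =
    {Piece.rep (k + 1), Piece.con (k + 1), Piece.rep (k + 2), Piece.block (k + 1)} := by
  ext a
  rcases a with j | j | j <;> simp [Tight, Piece.firstPair] <;> omega

theorem heads_con (k : ℕ) : {a : Piece | Tight (k, k + 1) a.firstPair} =
    {Piece.con (k + 1), Piece.rep (k + 2), Piece.con (k + 2), Piece.block (k + 1),
      Piece.block (k + 2)} := by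
  ext a
  rcases a with j | j | j <;> simp [Tight, Piece.firstPair] <;> omega

theorem heads_finite (x : ℕ × ℕ) : {a : Piece | Tight x a.firstPair}.Finite := by
  by_cases h : x.2 = x.1
  · obtain ⟨k, l⟩ := x
    obtain rfl : l = k := h
    rw [heads_rep]
    exact Set.toFinite _
  · by_cases h' : x.2 = x.1 + 1
    · obtain ⟨k, l⟩ := x
      obtain rfl : l = k + 1 := h'
      rw [heads_con]
      exact Set.toFinite _
    · convert Set.finite_empty
      ext a
      simp [Tight, h, h']

theorem packedSet_succ (x : ℕ × ℕ) (p : ℕ) :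
    packedSet x 0 (p + 1) = ⋃ a ∈ {a : Piece | Tight x a.firstPair},
      (a :: ·) '' packedSet a.lastPair a.pairs (p + 1) := by
  ext β
  rcases β with _ | ⟨a, β⟩
  · simp [packedSet, pairCount]
  · simp only [packedSet, Set.mem_ofPred_eq, packedAfter_cons, pairCount, List.map_cons,
      List.sum_cons, Set.mem_iUnion, Set.mem_image, List.cons.injEq, exists_prop]
    constructor
    · rintro ⟨⟨h1, h2⟩, h3⟩
      exact ⟨a, h1, β, ⟨h2, by omega⟩, rfl, rfl⟩
    · rintro ⟨b, h1, γ, ⟨h2, h3⟩, rfl, rfl⟩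
      exact ⟨⟨h1, h2⟩, by omega⟩

theorem packedSet_zero (x : ℕ × ℕ) : packedSet x 0 0 = {[]} := by
  ext β
  rcases β with _ | ⟨a, β⟩
  · simp [packedSet, pairCount, packedAfter_nil]
  · have := a.one_le_pairs
    simp [packedSet, pairCount]
    omega

theorem packedSet_succ_succ (x : ℕ × ℕ) (c p : ℕ) :
    packedSet x (c + 1) (p + 1) = packedSet x c p := by
  ext β
  simp only [packedSet, Set.mem_ofPred_eq, ← add_assoc, Nat.add_right_cancel_iff]

theorem packedSet_succ_zero (x : ℕ × ℕ) (c : ℕ) : packedSet x (c + 1) 0 = ∅ := by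
  ext β
  simp [packedSet]

theorem packedSet_finite (x : ℕ × ℕ) (c p : ℕ) : (packedSet x c p).Finite := by
  induction p using Nat.strong_induction_on generalizing x c with
  | _ p ih =>
    rcases p with _ | p
    · rcases c with _ | c
      · rw [packedSet_zero]
        exact Set.finite_singleton _
      · rw [packedSet_succ_zero]
        exact Set.finite_empty
    · rcases c with _ | c
      · rw [packedSet_succ]
        refine (heads_finite x).biUnion fun a _ => Set.Finite.image _ ?_
        obtain ⟨c, hc⟩ := Nat.exists_eq_add_of_le' a.one_le_pairs
        rw [hc, packedSet_succ_succ]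
        exact ih p (Nat.lt_succ_self p) _ _
      · rw [packedSet_succ_succ]
        exact ih p (Nat.lt_succ_self p) _ _

/-- The generating function of `packedSet x c p`. -/
noncomputable def packedGF (x : ℕ × ℕ) (c p : ℕ) : PowerSeries QSeries :=
  ∑ᶠ β ∈ packedSet x c p, baseTerm x β

theorem packedGF_succ_succ (x : ℕ × ℕ) (c p : ℕ) :
    packedGF x (c + 1) (p + 1) = packedGF x c p := by
  rw [packedGF, packedSet_succ_succ, packedGF]

theorem packedGF_succ_zero (x : ℕ × ℕ) (c : ℕ) : packedGF x (c + 1) 0 = 0 := by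
  rw [packedGF, packedSet_succ_zero, finsum_mem_empty]

theorem packedGF_zero (x : ℕ × ℕ) : packedGF x 0 0 = singletons x.1 := by
  rw [packedGF, packedSet_zero, finsum_mem_singleton]
  simp [baseTerm, partCount, baseWeight, lastLow]

/-- Summation over the first piece. Its number of pairs is recorded in the second argument, so that
pieces with one pair and blocks with two are treated alike. -/
theorem packedGF_succ (x : ℕ × ℕ) (p : ℕ) :
    packedGF x 0 (p + 1) = ∑ᶠ a ∈ {a : Piece | Tight x a.firstPair},
      PowerSeries.X ^ a.parts.length * PowerSeries.C (qsq ^ a.parts.sum) *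
        packedGF a.lastPair a.pairs (p + 1) := by
  rw [packedGF, packedSet_succ, finsum_mem_biUnion _ (heads_finite x)]
  · refine finsum_mem_congr rfl fun a _ => ?_
    rw [finsum_mem_image ((List.cons_injective).injOn), packedGF,
      mul_finsum_mem' _ _ (packedSet_finite _ _ _)]
    exact finsum_mem_congr rfl fun β _ => baseTerm_cons x a β
  · exact fun a _ => (packedSet_finite _ _ _).image _
  · intro a _ b _ hab
    refine Set.disjoint_left.mpr ?_
    rintro _ ⟨β, -, rfl⟩ ⟨γ, -, h⟩
    exact hab (List.cons.inj h).1.symm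

theorem packedGF_rep_succ (k p : ℕ) :
    packedGF (k, k) 0 (p + 1) =
      PowerSeries.X ^ 2 * PowerSeries.C (qsq ^ (2 * k + 2)) * packedGF (k + 1, k + 1) 0 p +
      PowerSeries.X ^ 2 * PowerSeries.C (qsq ^ (2 * k + 3)) * packedGF (k + 1, k + 2) 0 p +
      PowerSeries.X ^ 2 * PowerSeries.C (qsq ^ (2 * k + 4)) * packedGF (k + 2, k + 2) 0 p +
      PowerSeries.X ^ 5 * PowerSeries.C (qsq ^ (5 * k + 13)) * packedGF (k + 4, k + 4) 1 p := by
  rw [packedGF_succ, heads_rep, finsum_mem_insert _ (by simp) (Set.toFinite _),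
    finsum_mem_insert _ (by simp) (Set.toFinite _), finsum_mem_insert _ (by simp) (Set.toFinite _),
    finsum_mem_singleton]
  have e1 : (Piece.rep (k + 1)).parts.sum = 2 * k + 2 := by simp [Piece.parts]; ring
  have e2 : (Piece.con (k + 1)).parts.sum = 2 * k + 3 := by simp [Piece.parts]; ring
  have e3 : (Piece.rep (k + 2)).parts.sum = 2 * k + 4 := by simp [Piece.parts]; ring
  have e4 : (Piece.block (k + 1)).parts.sum = 5 * k + 13 := by simp [Piece.parts]; ring
  rw [e1, e2, e3, e4]
  simp only [Piece.parts, Piece.pairs, Piece.lastPair, packedGF_succ_succ, add_assoc,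
    List.length_cons, List.length_nil, Nat.reduceAdd]

theorem packedGF_con_succ (k p : ℕ) :
    packedGF (k, k + 1) 0 (p + 1) =
      PowerSeries.X ^ 2 * PowerSeries.C (qsq ^ (2 * k + 3)) * packedGF (k + 1, k + 2) 0 p +
      PowerSeries.X ^ 2 * PowerSeries.C (qsq ^ (2 * k + 4)) * packedGF (k + 2, k + 2) 0 p +
      PowerSeries.X ^ 2 * PowerSeries.C (qsq ^ (2 * k + 5)) * packedGF (k + 2, k + 3) 0 p +
      PowerSeries.X ^ 5 * PowerSeries.C (qsq ^ (5 * k + 13)) * packedGF (k + 4, k + 4) 1 p +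
      PowerSeries.X ^ 5 * PowerSeries.C (qsq ^ (5 * k + 18)) * packedGF (k + 5, k + 5) 1 p := by
  rw [packedGF_succ, heads_con, finsum_mem_insert _ (by simp) (Set.toFinite _),
    finsum_mem_insert _ (by simp) (Set.toFinite _), finsum_mem_insert _ (by simp) (Set.toFinite _),
    finsum_mem_insert _ (by simp) (Set.toFinite _), finsum_mem_singleton]
  have e1 : (Piece.con (k + 1)).parts.sum = 2 * k + 3 := by simp [Piece.parts]; ring
  have e2 : (Piece.rep (k + 2)).parts.sum = 2 * k + 4 := by simp [Piece.parts]; ring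
  have e3 : (Piece.con (k + 2)).parts.sum = 2 * k + 5 := by simp [Piece.parts]; ring
  have e4 : (Piece.block (k + 1)).parts.sum = 5 * k + 13 := by simp [Piece.parts]; ring
  have e5 : (Piece.block (k + 2)).parts.sum = 5 * k + 18 := by simp [Piece.parts]; ring
  rw [e1, e2, e3, e4, e5]
  simp only [Piece.parts, Piece.pairs, Piece.lastPair, packedGF_succ_succ, add_assoc,
    List.length_cons, List.length_nil, Nat.reduceAdd]

/-- Raising every part by one is the substitution `s ↦ s q^2`. The induction is strong because a
block uses two pairs. -/
theorem shift_packedGF (p : ℕ) : ∀ c k : ℕ,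
    packedGF (k + 1, k + 1) c p = shift (packedGF (k, k) c p) ∧
    packedGF (k + 1, k + 2) c p = shift (packedGF (k, k + 1) c p) := by
  induction p using Nat.strong_induction_on with
  | _ p ih =>
    rintro (_ | c) k
    · rcases p with _ | p
      · simp only [packedGF_zero, shift_singletons, and_self]
      · have h := fun c k => (ih p (Nat.lt_succ_self p) c k).1
        have h' := fun c k => (ih p (Nat.lt_succ_self p) c k).2
        rw [packedGF_rep_succ, packedGF_rep_succ, packedGF_con_succ, packedGF_con_succ]
        simp only [map_add, map_mul, map_pow, shift_C, shift_X, ← h, ← h']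
        simp only [sMulQ, Algebra.algebraMap_self, RingHom.id_apply]
        constructor <;> ring_nf
    · rcases p with _ | p
      · simp only [packedGF_succ_zero, map_zero, and_self]
      · simp only [packedGF_succ_succ]
        exact ih p (Nat.lt_succ_self p) c k

/-- The pairs `(0, 0)` and `(0, 1)` stand for the two types of predecessor. A second argument 1 is
the delay by one pair caused by a block, which supplies the sequence `Z`. -/
theorem packedGF_eq (p : ℕ) :
    packedGF (0, 0) 0 p = PowerSeries.C (cubeProd p) * withPairs p := by
  have h := fun p c k => (shift_packedGF p c k).1
  have h' := fun p c k => (shift_packedGF p c k).2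
  refine eq_cubeProd_mul_withPairs (packedGF (0, 0) 0) (packedGF (0, 1) 0) (packedGF (0, 0) 1)
    (packedGF_succ_zero _ _) (packedGF_succ_succ _ _) ?_ ?_ ?_ ?_ p
  · rw [packedGF_zero, singletons_zero]
  · rw [packedGF_zero, singletons_zero]
  · intro p
    rw [packedGF_rep_succ]
    simp only [← h, ← h', zero_add, Nat.reduceAdd]
    simp only [sMulQ, qC, Algebra.algebraMap_self, RingHom.id_apply, map_pow]
    ring
  · intro p
    rw [packedGF_con_succ]
    simp only [← h, ← h', zero_add, Nat.reduceAdd]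
    simp only [sMulQ, qC, Algebra.algebraMap_self, RingHom.id_apply, map_pow]
    ring

/-! ### The generating function of the partitions -/

/-- With `q^(n^2)` divided out, `krSet 1 3`, `krSet 2 4`, `krSet 2 2` correspond to `H`, `L` and `J
= L / (1 - s^2)`, and `krSet 1 2` to `H + s^2 J`. The functional equation of `L` is what the
recurrence for `krSet 2 4` demands, because `1/(1 - s) + s^2/(1 - s^2) = (1 + s + s^2)/(1 - s^2)`.
-/
theorem listGF_krSet_eq {L H : PowerSeries QSeries} (h0 : PowerSeries.coeff 0 L = 1)
    (hL : (1 - PowerSeries.C PowerSeries.X * PowerSeries.X) * (1 - sMulQ QSeries ^ 2) * L =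
      (1 + sMulQ _ + sMulQ _ ^ 2) * shift L)
    (hH : (1 - PowerSeries.X) * H = L) (N : ℕ) :
    listGF (krSet 1 3) N = PowerSeries.X ^ N ^ 2 * PowerSeries.coeff N H := by
  obtain ⟨J, hJ⟩ : ∃ J : PowerSeries QSeries, (1 - PowerSeries.X ^ 2) * J = L :=
    ⟨PowerSeries.invOfUnit (1 - PowerSeries.X ^ 2) 1 * L, by
      rw [← mul_assoc, PowerSeries.mul_invOfUnit _ _ (by simp), one_mul]⟩
  have hY : shift (H + PowerSeries.X ^ 2 * J) =
      (1 - PowerSeries.C PowerSeries.X * PowerSeries.X) * L := by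
    have h1 := congrArg shift hH
    have h2 := congrArg shift hJ
    simp only [map_mul, map_sub, map_add, map_pow, map_one, shift_X] at h1 h2 ⊢
    have hne : (1 - sMulQ QSeries ^ 2 : PowerSeries QSeries) ≠ 0 := by
      intro h
      have := congrArg (PowerSeries.coeff 0) h
      simp [sMulQ] at this
    refine mul_left_cancel₀ hne ?_
    linear_combination (1 + sMulQ QSeries) * h1 + sMulQ QSeries ^ 2 * h2 - hL
  have hHs (n : ℕ) : PowerSeries.coeff (n + 1) H =
      PowerSeries.coeff n H + PowerSeries.coeff (n + 1) L := by
    have := congrArg (PowerSeries.coeff (n + 1)) hH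
    rw [sub_mul, one_mul, map_sub, PowerSeries.coeff_succ_X_mul] at this
    linear_combination this
  have hH0 : PowerSeries.coeff 0 H = 1 := by
    rw [← h0, ← hH]
    simp
  have hJs (n : ℕ) : PowerSeries.coeff (n + 2) J =
      PowerSeries.coeff n J + PowerSeries.coeff (n + 2) L := by
    have := congrArg (PowerSeries.coeff (n + 2)) hJ
    rw [sub_mul, one_mul, map_sub, PowerSeries.coeff_X_pow_mul] at this
    linear_combination this
  have hJ0 : PowerSeries.coeff 0 J = 1 := by
    rw [← h0, ← hJ]
    simp
  have hJ1 : PowerSeries.coeff 1 J = PowerSeries.coeff 1 L := by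
    rw [← hJ, sub_mul, one_mul, map_sub, PowerSeries.coeff_X_pow_mul']
    simp
  have hYs (n : ℕ) : qsq ^ (n + 1) * PowerSeries.coeff (n + 1) (H + PowerSeries.X ^ 2 * J) =
      PowerSeries.coeff (n + 1) L - PowerSeries.X * PowerSeries.coeff n L := by
    have := congrArg (PowerSeries.coeff (n + 1)) hY
    rw [coeff_shift, sub_mul, one_mul, map_sub, mul_assoc, PowerSeries.coeff_C_mul,
      PowerSeries.coeff_succ_X_mul] at this
    exact this
  simp only [map_add] at hYs
  let P (n : ℕ) : Prop :=
    listGF (krSet 1 3) n = PowerSeries.X ^ n ^ 2 * PowerSeries.coeff n H ∧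
    listGF (krSet 2 4) n = PowerSeries.X ^ n ^ 2 * PowerSeries.coeff n L ∧
    listGF (krSet 2 2) n = PowerSeries.X ^ n ^ 2 * PowerSeries.coeff n J
  have hP0 : P 0 := by
    simp only [P, listGF_krSet_zero, hH0, h0, hJ0]
    simp
  have hne (n : ℕ) : (1 - PowerSeries.X ^ (2 * n + 2) : QSeries) ≠ 0 := by
    have := one_sub_qsq_pow_ne_zero n
    rwa [qsq, ← pow_mul, mul_add] at this
  have hP1 : P 1 := by
    have a := listGF_one_three_succ 0
    have b := listGF_two_four_succ 0
    have c := hYs 0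
    have e := hHs 0
    simp only [zero_add, listGF_krSet_zero, listGF_one_two_one, hH0, h0, mul_zero,
      PowerSeries.coeff_X_pow_mul'] at a b c e
    rw [if_neg (by norm_num), add_zero, qsq] at c
    have h1 : listGF (krSet 2 4) 1 = PowerSeries.X * PowerSeries.coeff 1 L := by
      -- The recurrences for `krSet 2 4` and `krSet 1 3` refer to each other at the same length;
      -- eliminating one leaves the factor `1 - q^2`.
      refine mul_left_cancel₀ (hne 0) ?_
      linear_combination b + PowerSeries.X ^ 2 * a - PowerSeries.X ^ 3 * e + PowerSeries.X * c
    refine ⟨?_, ?_, ?_⟩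
    · linear_combination a + h1 - PowerSeries.X * e
    · linear_combination h1
    · rw [listGF_two_two_one, hJ1]
      linear_combination h1
  have hP (n : ℕ) : P n ∧ P (n + 1) := by
    induction n with
    | zero => exact ⟨hP0, hP1⟩
    | succ n ih =>
      refine ⟨ih.2, ?_⟩
      obtain ⟨⟨-, -, j0⟩, k1, l1, -⟩ := ih
      have a := listGF_one_three_succ (n + 1)
      have b := listGF_two_four_succ (n + 1)
      have c := hYs (n + 1)
      have e := hHs (n + 1)
      have f := listGF_one_two n
      have g := listGF_two_two n
      have hX : PowerSeries.coeff (n + 2) (PowerSeries.X ^ 2 * J) = PowerSeries.coeff n J :=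
        PowerSeries.coeff_X_pow_mul J 2 n
      simp only [add_assoc, Nat.reduceAdd] at c e
      rw [hX, qsq, ← pow_mul] at c
      rw [j0] at f g
      rw [k1] at a
      rw [l1] at b
      have h1 : listGF (krSet 2 4) (n + 2) =
          PowerSeries.X ^ (n + 2) ^ 2 * PowerSeries.coeff (n + 2) L := by
        refine mul_left_cancel₀ (hne (n + 1)) ?_
        linear_combination b + PowerSeries.X ^ (2 * (n + 1) + 2) * (f + a) -
          PowerSeries.X ^ ((n + 2) ^ 2 + 2 * (n + 1) + 2) * e + PowerSeries.X ^ (n + 2) ^ 2 * c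
      refine ⟨?_, h1, ?_⟩
      · linear_combination a + h1 - PowerSeries.X ^ (n + 2) ^ 2 * e
      · linear_combination g + h1 - PowerSeries.X ^ (n + 2) ^ 2 * hJs n
  exact (hP N).1.1

/-! ### Locally finite families of monomials -/

/-- The family of the monomials `c a * s ^ d a` is locally finite with sum `f`. -/
def HasGF {α : Type*} (d : α → ℕ) (c : α → QSeries) (f : PowerSeries QSeries) : Prop :=
  ∀ N, ∃ s : Finset α, (∀ a ∈ s, d a = N) ∧ (∀ a, d a = N → c a ≠ 0 → a ∈ s) ∧
    ∑ a ∈ s, c a = PowerSeries.coeff N f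

namespace HasGF
variable {α β : Type*} {d : α → ℕ} {c : α → QSeries} {f : PowerSeries QSeries}

theorem mul {d' : β → ℕ} {c' : β → QSeries} {f' : PowerSeries QSeries} (h : HasGF d c f)
    (h' : HasGF d' c' f') :
    HasGF (fun x : α × β => d x.1 + d' x.2) (fun x => c x.1 * c' x.2) (f * f') := by
  classical
  choose s hd hm hs using h
  choose s' hd' hm' hs' using h'
  intro N
  refine ⟨(Finset.HasAntidiagonal.antidiagonal N).biUnion fun p => s p.1 ×ˢ s' p.2, ?_, ?_, ?_⟩
  · rintro ⟨a, b⟩ hab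
    obtain ⟨p, hp, hab⟩ := Finset.mem_biUnion.mp hab
    obtain ⟨ha, hb⟩ := Finset.mem_product.mp hab
    change d a + d' b = N
    rw [hd _ a ha, hd' _ b hb]
    exact Finset.HasAntidiagonal.mem_antidiagonal.mp hp
  · rintro ⟨a, b⟩ hab hc
    refine Finset.mem_biUnion.mpr ⟨(d a, d' b), Finset.HasAntidiagonal.mem_antidiagonal.mpr hab,
      Finset.mem_product.mpr ⟨hm _ a rfl (left_ne_zero_of_mul hc),
        hm' _ b rfl (right_ne_zero_of_mul hc)⟩⟩
  · rw [Finset.sum_biUnion, PowerSeries.coeff_mul]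
    · refine Finset.sum_congr rfl fun p _ => ?_
      rw [Finset.sum_product, ← hs, ← hs', Finset.sum_mul_sum]
    · intro p _ r _ hpr
      refine Finset.disjoint_left.mpr fun x hx hx' => hpr ?_
      obtain ⟨h1, h2⟩ := Finset.mem_product.mp hx
      obtain ⟨h3, h4⟩ := Finset.mem_product.mp hx'
      exact Prod.ext ((hd _ _ h1).symm.trans (hd _ _ h3)) ((hd' _ _ h2).symm.trans (hd' _ _ h4))

theorem comp_equiv (h : HasGF d c f) (e : β ≃ α) : HasGF (d ∘ e) (c ∘ e) f := by
  intro N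
  obtain ⟨s, hd, hm, hs⟩ := h N
  refine ⟨s.map e.symm.toEmbedding, ?_, ?_, ?_⟩
  · intro b hb
    obtain ⟨a, ha, rfl⟩ := Finset.mem_map.mp hb
    simpa using hd a ha
  · intro b hb hc
    exact Finset.mem_map.mpr ⟨e b, hm _ hb hc, by simp⟩
  · rw [← hs, Finset.sum_map]
    simp

/-- Collecting the members of the family with the same image under `φ`. -/
theorem fiberwise {d' : β → ℕ} {c' : β → QSeries} (φ : α → β) (hφ : ∀ a, d' (φ a) = d a)
    (hc : ∀ (b : β) (s : Finset α), (∀ a ∈ s, φ a = b) → (∀ a, φ a = b → c a ≠ 0 → a ∈ s) →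
      ∑ a ∈ s, c a = c' b) (h : HasGF d c f) : HasGF d' c' f := by
  classical
  intro N
  obtain ⟨s, hd, hm, hs⟩ := h N
  have key (b : β) (hb : d' b = N) : ∑ a ∈ s with φ a = b, c a = c' b := by
    refine hc b _ (fun a ha => (Finset.mem_filter.mp ha).2) fun a ha hca => ?_
    refine Finset.mem_filter.mpr ⟨hm a ?_ hca, ha⟩
    rw [← hφ, ha, hb]
  have hd' : ∀ b ∈ s.image φ, d' b = N := by
    intro b hb
    obtain ⟨a, ha, rfl⟩ := Finset.mem_image.mp hb
    rw [hφ, hd a ha]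
  refine ⟨s.image φ, hd', ?_, ?_⟩
  · intro b hb hcb
    by_contra hn
    refine hcb ?_
    rw [← key b hb]
    refine Finset.sum_eq_zero fun a ha => ?_
    obtain ⟨ha', rfl⟩ := Finset.mem_filter.mp ha
    exact absurd (Finset.mem_image_of_mem φ ha') hn
  · rw [← hs, ← Finset.sum_fiberwise_of_maps_to (fun a ha => Finset.mem_image_of_mem φ ha)]
    exact Finset.sum_congr rfl fun b hb => (key b (hd' b hb)).symm

theorem of_coeff (f : PowerSeries QSeries) : HasGF id (fun n => PowerSeries.coeff n f) f :=
  fun N => ⟨{N}, by simp, by simp, by simp⟩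

end HasGF

/-! ### The factors of the multiple series -/

/-- The generating function of the odd moveable singletons. -/
noncomputable def oddSeries : PowerSeries QSeries :=
  PowerSeries.mk fun n => PowerSeries.X ^ n * qInvPochhammer 2 n

/-- The generating function of the repeated even moveable singletons. -/
noncomputable def evenSeries : PowerSeries QSeries :=
  PowerSeries.mk fun n =>
    if Even n then PowerSeries.X ^ (4 * (n / 2)) * qInvPochhammer 4 (n / 2) else 0

theorem evenSeries_hasGF : HasGF (fun j => 2 * j)
    (fun j => PowerSeries.X ^ (4 * j) * qInvPochhammer 4 j) evenSeries := by
  intro N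
  by_cases hN : Even N
  · obtain ⟨j, rfl⟩ := even_iff_exists_two_mul.mp hN
    refine ⟨{j}, by simp, by simp, ?_⟩
    simp [evenSeries]
  · refine ⟨∅, by simp, ?_, by simp [evenSeries, hN]⟩
    rintro j rfl
    exact absurd (even_two_mul j) hN

/-- The functional equation of Euler's product `1 / (s q; q^2)_∞`. -/
theorem oddSeries_eq :
    (1 - PowerSeries.C PowerSeries.X * PowerSeries.X) * oddSeries = shift oddSeries := by
  ext1 n
  rw [sub_mul, one_mul, map_sub, coeff_shift, mul_assoc, PowerSeries.coeff_C_mul]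
  rcases n with _ | n
  · simp
  · rw [PowerSeries.coeff_succ_X_mul]
    simp only [oddSeries, PowerSeries.coeff_mk, qsq, Algebra.algebraMap_self, RingHom.id_apply]
    have h := mul_qInvPochhammer_succ (s := 2) (by norm_num) n
    linear_combination PowerSeries.X ^ (n + 1) * h

/-- The functional equation of `1 / (s^2 q^4; q^4)_∞`; only even powers of `s` occur. -/
theorem evenSeries_eq : (1 - sMulQ QSeries ^ 2) * evenSeries = shift evenSeries := by
  ext1 n
  rw [sub_mul, one_mul, map_sub, coeff_shift, sMulQ, mul_pow, ← map_pow, mul_assoc,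
    PowerSeries.coeff_C_mul, PowerSeries.coeff_X_pow_mul']
  simp only [Algebra.algebraMap_self, RingHom.id_apply, evenSeries, PowerSeries.coeff_mk, qsq]
  rcases Nat.even_or_odd' n with ⟨j, rfl | rfl⟩
  · rcases j with _ | j
    · simp
    · have h := mul_qInvPochhammer_succ (s := 4) (by norm_num) j
      have e : 2 * (j + 1) - 2 = 2 * j := by omega
      rw [if_pos (even_two_mul (j + 1)), if_pos (show 2 ≤ 2 * (j + 1) by omega), e,
        if_pos (even_two_mul j), Nat.mul_div_cancel_left _ two_pos, Nat.mul_div_cancel_left _ two_pos]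
      linear_combination PowerSeries.X ^ (4 * (j + 1)) * h
  · have h1 : ¬ Even (2 * j + 1) := by simp
    rw [if_neg h1, mul_zero, zero_sub, neg_eq_zero]
    split_ifs with h2 h3
    · rw [Nat.even_sub h2] at h3
      simp at h3
    · simp
    · simp

theorem pairCount_le_partCount (β : List Piece) : pairCount β ≤ partCount β := by
  induction β with
  | nil => simp [pairCount]
  | cons a β ih =>
    simp only [pairCount, partCount, List.map_cons, List.sum_cons] at ih ⊢
    refine Nat.add_le_add ?_ ih
    rcases a with k | k | k <;> simp [Piece.pairs, Piece.parts]

open Classical in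
/-- The contribution of a base partition and `n` singletons of the kind `n₁₂`. -/
noncomputable def baseCoeff (x : List Piece × ℕ) : QSeries :=
  if PackedAfter (0, 0) x.1 then
    qsq ^ baseWeight x.1 * (qsq ^ (x.2 ^ 2 + lastLow (0, 0) x.1 * x.2) * qInvPochhammer 2 x.2) *
      qInvPochhammer 6 (pairCount x.1) else 0

theorem coeff_baseTerm (x : ℕ × ℕ) (β : List Piece) (N : ℕ) :
    PowerSeries.coeff N (baseTerm x β) = if partCount β ≤ N then
      qsq ^ baseWeight β * PowerSeries.coeff (N - partCount β) (singletons (lastLow x β)) else 0 := by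
  rw [baseTerm, mul_assoc, PowerSeries.coeff_X_pow_mul']
  simp only [PowerSeries.coeff_C_mul]

/-- Dividing `packedGF_eq` by `(q^6; q^6)_p`. Once `β` is chosen, the total number `N` of parts
fixes the number of singletons. -/
theorem coeff_withPairs (N p : ℕ) : PowerSeries.coeff N (withPairs p) =
    ∑ β ∈ (packedSet_finite (0, 0) 0 p).toFinset with partCount β ≤ N,
      baseCoeff (β, N - partCount β) := by
  have h : withPairs p = PowerSeries.C (qInvPochhammer 6 p) * packedGF (0, 0) 0 p := by
    rw [packedGF_eq, ← mul_assoc, ← map_mul, mul_comm (qInvPochhammer 6 p),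
      cubeProd_mul_qInvPochhammer, map_one, one_mul]
  rw [h, PowerSeries.coeff_C_mul, packedGF,
    finsum_mem_eq_finite_toFinset_sum _ (packedSet_finite _ _ _), map_sum, Finset.mul_sum,
    Finset.sum_filter]
  refine Finset.sum_congr rfl fun β hβ => ?_
  obtain ⟨h1, h2⟩ := (Set.Finite.mem_toFinset _).mp hβ
  rw [coeff_baseTerm]
  split_ifs
  · rw [baseCoeff, if_pos h1, singletons, PowerSeries.coeff_mk]
    simp only [add_zero] at h2
    simp only [h2]
    ring
  · rw [mul_zero]

theorem atMostTwice_hasGF :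
    HasGF (fun x : List Piece × ℕ => partCount x.1 + x.2) baseCoeff atMostTwice := by
  classical
  intro N
  let t (p : ℕ) : Finset (List Piece) :=
    (packedSet_finite (0, 0) 0 p).toFinset.filter fun β => partCount β ≤ N
  have ht {p : ℕ} {β : List Piece} :
      β ∈ t p ↔ (PackedAfter (0, 0) β ∧ pairCount β = p) ∧ partCount β ≤ N := by
    simp [t, packedSet]
  refine ⟨((Finset.range (N + 1)).biUnion t).image fun β => (β, N - partCount β), ?_, ?_, ?_⟩
  · intro x hx
    obtain ⟨β, hβ, rfl⟩ := Finset.mem_image.mp hx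
    obtain ⟨p, -, hβ⟩ := Finset.mem_biUnion.mp hβ
    have := (ht.mp hβ).2
    change partCount β + (N - partCount β) = N
    omega
  · rintro ⟨β, n⟩ hN hc
    change partCount β + n = N at hN
    have hβ : PackedAfter (0, 0) β := by
      by_contra h
      exact hc (if_neg h)
    have := pairCount_le_partCount β
    refine Finset.mem_image.mpr ⟨β, Finset.mem_biUnion.mpr ⟨pairCount β,
      Finset.mem_range.mpr (by omega), ht.mpr ⟨⟨hβ, rfl⟩, by omega⟩⟩, ?_⟩
    exact Prod.ext rfl (by change N - partCount β = n; omega)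
  · rw [Finset.sum_image (fun β _ γ _ h => (Prod.ext_iff.mp h).1), Finset.sum_biUnion,
      coeff_atMostTwice]
    · exact Finset.sum_congr rfl fun p _ => (coeff_withPairs N p).symm
    · intro p _ r _ hpr
      exact Finset.disjoint_left.mpr fun β h h' =>
        hpr ((ht.mp h).1.2.symm.trans (ht.mp h').1.2)

/-- The admissible smallest pairs are exactly those that fit tightly after a fictitious pair `[0,
0]`. -/
theorem isBase_iff (β : List Piece) : IsBase β ↔ PackedAfter (0, 0) β := by
  simp [IsBase, PackedAfter, Tight]

theorem nextSingleton_eq (β : List Piece) : nextSingleton β = lastLow (0, 0) β + 1 := by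
  rw [nextSingleton, lastLow]
  cases β.getLast? <;> rfl

theorem pairCount_eq (β : List Piece) :
    pairCount β = β.countP Piece.isRep + β.countP Piece.isCon + 2 * β.countP Piece.isBlock := by
  induction β with
  | nil => simp [pairCount]
  | cons a β ih =>
    simp only [pairCount, List.map_cons, List.sum_cons, List.countP_cons] at ih ⊢
    rcases a with k | k | k <;> simp [Piece.pairs, Piece.isRep, Piece.isCon, Piece.isBlock, ih] <;>
      omega

theorem partCount_eq (β : List Piece) : partCount β =
    2 * β.countP Piece.isRep + 2 * β.countP Piece.isCon + 5 * β.countP Piece.isBlock := by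
  induction β with
  | nil => simp [partCount]
  | cons a β ih =>
    simp only [partCount, List.map_cons, List.sum_cons, List.countP_cons] at ih ⊢
    rw [ih]
    rcases a with k | k | k <;> simp [Piece.parts, Piece.isRep, Piece.isCon, Piece.isBlock] <;>
      omega

theorem aeval_P {R : Type*} [CommSemiring R] [Algebra ℕ R] (x : R) (m₁ m₂ m₃ M : ℕ) :
    Polynomial.aeval x (P m₁ m₂ m₃ M) =
      ∑ β ∈ (basePartitions_finite m₁ m₂ m₃ M).toFinset, x ^ baseWeight β := by
  rw [P, finsum_mem_eq_finite_toFinset_sum _ (basePartitions_finite _ _ _ _), map_sum]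
  simp

/-- The part of the summand that depends on the base partition. -/
noncomputable def baseSummand : ℕ × ℕ × ℕ × ℕ × ℕ → QSeries
  | (m₁, m₂, m₃, m, n) => Polynomial.aeval qsq (P m₁ m₂ m₃ (m + 1)) *
      (qsq ^ (n ^ 2 + m * n) * qInvPochhammer 2 n) * qInvPochhammer 6 (m₁ + m₂ + 2 * m₃)

theorem baseSummand_hasGF :
    HasGF (fun x : ℕ × ℕ × ℕ × ℕ × ℕ => 2 * x.1 + 2 * x.2.1 + 5 * x.2.2.1 + x.2.2.2.2)
      baseSummand atMostTwice := by
  classical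
  refine atMostTwice_hasGF.fiberwise (fun x => (x.1.countP Piece.isRep, x.1.countP Piece.isCon,
    x.1.countP Piece.isBlock, lastLow (0, 0) x.1, x.2)) ?_ ?_
  · rintro ⟨β, n⟩
    rw [partCount_eq]
  · rintro ⟨m₁, m₂, m₃, m, n⟩ s hs hs'
    have hmem {β : List Piece} : β ∈ (basePartitions_finite m₁ m₂ m₃ (m + 1)).toFinset ↔
        PackedAfter (0, 0) β ∧ β.countP Piece.isRep = m₁ ∧ β.countP Piece.isCon = m₂ ∧
          β.countP Piece.isBlock = m₃ ∧ lastLow (0, 0) β = m := by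
      rw [Set.Finite.mem_toFinset]
      simp only [basePartitions, Set.mem_ofPred_eq, isBase_iff, nextSingleton_eq,
        Nat.add_right_cancel_iff]
    have h1 : baseSummand (m₁, m₂, m₃, m, n) =
        ∑ x ∈ (basePartitions_finite m₁ m₂ m₃ (m + 1)).toFinset.image (fun β => (β, n)),
          baseCoeff x := by
      rw [Finset.sum_image (fun β _ γ _ h => (Prod.ext_iff.mp h).1), baseSummand, aeval_P,
        Finset.sum_mul, Finset.sum_mul]
      refine Finset.sum_congr rfl fun β hβ => ?_
      obtain ⟨hp, rfl, rfl, rfl, rfl⟩ := hmem.mp hβ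
      rw [baseCoeff, if_pos hp, pairCount_eq]
    -- The given set `s` need only contain the nonzero terms of the fibre, so the two index sets are
    -- compared after discarding zero terms.
    rw [h1, ← Finset.sum_filter_ne_zero, ← Finset.sum_filter_ne_zero (s := Finset.image _ _)]
    refine Finset.sum_congr ?_ fun _ _ => rfl
    ext ⟨β, k⟩
    simp only [Finset.mem_filter, Finset.mem_image, hmem, Prod.mk.injEq]
    refine and_congr_left fun hc => ?_
    have hp : PackedAfter (0, 0) β := by
      by_contra h
      exact hc (if_neg h)
    constructor
    · intro h
      have := hs _ h
      simp only [Prod.mk.injEq] at this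
      exact ⟨β, ⟨hp, this.1, this.2.1, this.2.2.1, this.2.2.2.1⟩, rfl, this.2.2.2.2.symm⟩
    · rintro ⟨γ, ⟨-, a, b, c, e⟩, rfl, rfl⟩
      exact hs' _ (by simp only [a, b, c, e]) hc

/-- The multiple series without the factor that depends on the number of parts only. -/
noncomputable def multiSeries : PowerSeries QSeries :=
  atMostTwice * oddSeries * evenSeries * PowerSeries.mk 1

theorem listGF_eq_multiSeries (N : ℕ) :
    listGF (krSet 1 3) N = PowerSeries.X ^ N ^ 2 * PowerSeries.coeff N multiSeries := by
  refine listGF_krSet_eq (L := atMostTwice * oddSeries * evenSeries) ?_ ?_ ?_ N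
  · have h : PowerSeries.coeff 0 atMostTwice = 1 := by
      rw [atMostTwice, PowerSeries.coeff_map, pairedZero, PowerSeries.coeff_mk]
      simp [pairedCoeff]
    rw [PowerSeries.coeff_zero_eq_constantCoeff_apply] at h
    simp [h, oddSeries, evenSeries, qInvPochhammer_zero]
  · rw [map_mul, map_mul]
    linear_combination (1 - PowerSeries.C PowerSeries.X * PowerSeries.X) * (1 - sMulQ QSeries ^ 2) *
      oddSeries * evenSeries * atMostTwice_eq + (1 + sMulQ QSeries + sMulQ QSeries ^ 2) *
      shift atMostTwice * ((1 - sMulQ QSeries ^ 2) * evenSeries * oddSeries_eq +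
        shift oddSeries * evenSeries_eq)
  · rw [multiSeries, mul_comm, mul_assoc, PowerSeries.mk_one_mul_one_sub_eq_one, mul_one]

/-- The exponent of `t` in the summand. -/
def termDegree (x : ℕ × ℕ × ℕ × ℕ × ℕ × ℕ × ℕ × ℕ) : ℕ :=
  2 * x.1 + 2 * x.2.1 + 5 * x.2.2.1 + x.2.2.2.2.1 + x.2.2.2.2.2.1 + 2 * x.2.2.2.2.2.2.1 +
    x.2.2.2.2.2.2.2

/-- The coefficient of the power of `t` in the summand, without the quadratic power of `q`. -/
noncomputable def termCoeff (x : ℕ × ℕ × ℕ × ℕ × ℕ × ℕ × ℕ × ℕ) : QSeries :=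
  baseSummand (x.1, x.2.1, x.2.2.1, x.2.2.2.1, x.2.2.2.2.1) *
    (PowerSeries.X ^ x.2.2.2.2.2.1 * qInvPochhammer 2 x.2.2.2.2.2.1) *
    (PowerSeries.X ^ (4 * x.2.2.2.2.2.2.1) * qInvPochhammer 4 x.2.2.2.2.2.2.1)

theorem termCoeff_hasGF : HasGF termDegree termCoeff multiSeries := by
  have h := (((baseSummand_hasGF.mul (HasGF.of_coeff oddSeries)).mul evenSeries_hasGF).mul
    (HasGF.of_coeff (PowerSeries.mk 1))).comp_equiv
    { toFun := fun x : ℕ × ℕ × ℕ × ℕ × ℕ × ℕ × ℕ × ℕ =>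
        ((((x.1, x.2.1, x.2.2.1, x.2.2.2.1, x.2.2.2.2.1), x.2.2.2.2.2.1), x.2.2.2.2.2.2.1),
          x.2.2.2.2.2.2.2)
      invFun := fun y => (y.1.1.1.1, y.1.1.1.2.1, y.1.1.1.2.2.1, y.1.1.1.2.2.2.1,
        y.1.1.1.2.2.2.2, y.1.1.2, y.1.2, y.2)
      left_inv := fun _ => rfl
      right_inv := fun _ => rfl }
  -- The extra factor 1 is the coefficient of `s^k` in `1 / (1 - s)`.
  have hc : termCoeff = _ := funext fun x => (mul_one (termCoeff x)).symm
  rw [hc]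
  convert h using 1
  · ext1 ⟨m₁, m₂, m₃, m, n, i, j, k⟩
    rfl
  · ext1 ⟨m₁, m₂, m₃, m, n, i, j, k⟩
    simp only [termCoeff, oddSeries, Function.comp, Equiv.coe_fn_mk, PowerSeries.coeff_mk,
      Pi.one_apply]
  · rfl

/-! ### The series in two variables -/

/-- The inclusion of the power series in `q` into those in `q` and `t`. -/
noncomputable def toQT : QSeries →ₐ[ℤ] QTSeries :=
  MvPowerSeries.rename (fun _ : Unit => (0 : Fin 2))

theorem toQT_X : toQT PowerSeries.X = qvar := MvPowerSeries.rename_X _ ()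

theorem coeff_toQT (f : QSeries) (d : Fin 2 →₀ ℕ) :
    MvPowerSeries.coeff d (toQT f) = if d 1 = 0 then PowerSeries.coeff (d 0) f else 0 := by
  split_ifs with h
  · let e : Unit ↪ Fin 2 := ⟨fun _ => 0, fun _ _ _ => rfl⟩
    have hd : d = Finsupp.embDomain e (Finsupp.single () (d 0)) := by
      rw [Finsupp.embDomain_single]
      ext i
      fin_cases i
      · exact (Finsupp.single_eq_same).symm
      · exact h.trans (Finsupp.single_eq_of_ne (by decide)).symm
    conv_lhs => rw [hd]
    exact MvPowerSeries.coeff_embDomain_rename e f _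
  · refine MvPowerSeries.coeff_rename_eq_zero _ _ ?_
    rintro ⟨x, rfl⟩
    exact h (Finsupp.mapDomain_of_notMem_range _ _ (by simp))

theorem coeff_toQT_mul_tvar_pow (f : QSeries) (e : ℕ) (d : Fin 2 →₀ ℕ) :
    MvPowerSeries.coeff d (toQT f * tvar ^ e) =
      if e = d 1 then PowerSeries.coeff (d 0) f else 0 := by
  rw [tvar, MvPowerSeries.X_pow_eq, MvPowerSeries.coeff_mul_monomial, mul_one, coeff_toQT]
  have h0 : (d - Finsupp.single 1 e : Fin 2 →₀ ℕ) 0 = d 0 := by simp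
  have h1 : (d - Finsupp.single 1 e : Fin 2 →₀ ℕ) 1 = d 1 - e := by simp
  simp only [h0, h1, Finsupp.single_le_iff]
  split_ifs <;> first | rfl | omega

theorem toQT_qInvPochhammer {s : ℕ} (hs : s ≠ 0) (n : ℕ) :
    toQT (qInvPochhammer s n) = invPochhammer s n := by
  have h1 := qPochhammer_mul_invPochhammer s n (Nat.pos_of_ne_zero hs)
  have h2 := congrArg toQT (prod_mul_qInvPochhammer hs n)
  simp only [map_mul, map_prod, map_sub, map_one, map_pow, toQT_X] at h2
  change qPochhammer (qvar ^ s) (qvar ^ s) n * _ = 1 at h2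
  refine mul_left_cancel₀ (left_ne_zero_of_mul_eq_one h1) ?_
  rw [h1, h2]

theorem toQT_aeval (p : Polynomial ℕ) :
    toQT (Polynomial.aeval qsq p) = Polynomial.aeval (qvar ^ 2) p := by
  have h : toQT qsq = qvar ^ 2 := by rw [qsq, map_pow, toQT_X]
  rw [← h, Polynomial.aeval_def, Polynomial.aeval_def]
  refine (Polynomial.hom_eval₂ p _ (toQT : QSeries →+* QTSeries) qsq).trans ?_
  congr 1
  exact Subsingleton.elim _ _

theorem krTerm_eq (m₁ m₂ m₃ m n i j k : ℕ) : krTerm m₁ m₂ m₃ m n i j k =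
    toQT (PowerSeries.X ^ termDegree (m₁, m₂, m₃, m, n, i, j, k) ^ 2 *
      termCoeff (m₁, m₂, m₃, m, n, i, j, k)) *
      tvar ^ termDegree (m₁, m₂, m₃, m, n, i, j, k) := by
  simp only [krTerm, termCoeff, baseSummand, map_mul, toQT_aeval]
  simp only [map_pow, toQT_X, qsq,
    toQT_qInvPochhammer (s := 2) (by norm_num), toQT_qInvPochhammer (s := 4) (by norm_num),
    toQT_qInvPochhammer (s := 6) (by norm_num)]
  simp only [termDegree]
  ring

/-! ### Positivity -/

/-- All coefficients are non-negative. -/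
def CoeffNonneg (f : QSeries) : Prop := ∀ n, 0 ≤ PowerSeries.coeff n f

namespace CoeffNonneg

theorem mul {f g : QSeries} (hf : CoeffNonneg f) (hg : CoeffNonneg g) : CoeffNonneg (f * g) := by
  intro n
  rw [PowerSeries.coeff_mul]
  exact Finset.sum_nonneg fun p _ => mul_nonneg (hf _) (hg _)

theorem X_pow (k : ℕ) : CoeffNonneg (PowerSeries.X ^ k) := by
  intro n
  rw [PowerSeries.coeff_X_pow]
  split_ifs <;> norm_num

/-- The new factor `1 / (1 - q^(s(n+1)))` makes each coefficient the sum of one for `n` and an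
earlier one for `n + 1`. -/
theorem qInvPochhammer {s : ℕ} (hs : s ≠ 0) (n : ℕ) : CoeffNonneg (qInvPochhammer s n) := by
  induction n with
  | zero =>
    rw [qInvPochhammer_zero, ← pow_zero PowerSeries.X]
    exact X_pow 0
  | succ n ih =>
    intro m
    induction m using Nat.strong_induction_on with
    | _ m hm =>
      have h := congrArg (PowerSeries.coeff m) (mul_qInvPochhammer_succ hs n)
      rw [sub_mul, one_mul, map_sub, PowerSeries.coeff_X_pow_mul'] at h
      have := ih m
      split_ifs at h with hle
      · have hpos : 0 < s * (n + 1) := Nat.mul_pos (Nat.pos_of_ne_zero hs) n.succ_pos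
        have := hm (m - s * (n + 1)) (by omega)
        omega
      · omega

theorem aeval_P (m₁ m₂ m₃ M : ℕ) : CoeffNonneg (Polynomial.aeval qsq (P m₁ m₂ m₃ M)) := by
  intro n
  rw [_root_.aeval_P, map_sum]
  refine Finset.sum_nonneg fun β _ => ?_
  rw [qsq, ← pow_mul]
  exact X_pow _ n

theorem termCoeff (x : ℕ × ℕ × ℕ × ℕ × ℕ × ℕ × ℕ × ℕ) : CoeffNonneg (termCoeff x) := by
  obtain ⟨m₁, m₂, m₃, m, n, i, j, k⟩ := x
  have hq (a : ℕ) : CoeffNonneg (qsq ^ a) := by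
    rw [qsq, ← pow_mul]
    exact X_pow _
  have h2 := fun n => qInvPochhammer (s := 2) (by norm_num) n
  have h4 := fun n => qInvPochhammer (s := 4) (by norm_num) n
  have h6 := fun n => qInvPochhammer (s := 6) (by norm_num) n
  exact ((((aeval_P _ _ _ _).mul ((hq _).mul (h2 _))).mul (h6 _)).mul
    ((X_pow _).mul (h2 _))).mul ((X_pow _).mul (h4 _))

end CoeffNonneg

theorem theorem1p5 :
    HasSum
        (fun x : ℕ × ℕ × ℕ × ℕ × ℕ × ℕ × ℕ × ℕ =>
          match x with
          | (m₁, m₂, m₃, m, n₁₂, i, j, k) => krTerm m₁ m₂ m₃ m n₁₂ i j k)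
        krSeries ∧
      ∀ (m₁ m₂ m₃ m n₁₂ i j k : ℕ) (d : Fin 2 →₀ ℕ),
        0 ≤ MvPowerSeries.coeff d (krTerm m₁ m₂ m₃ m n₁₂ i j k) := by
  constructor
  · rw [MvPowerSeries.WithPiTopology.hasSum_iff_hasSum_coeff]
    intro d
    obtain ⟨s, hd, hm, hs⟩ := termCoeff_hasGF (d 1)
    have hterm (x : ℕ × ℕ × ℕ × ℕ × ℕ × ℕ × ℕ × ℕ) : MvPowerSeries.coeff d
        (match x with
          | (m₁, m₂, m₃, m, n₁₂, i, j, k) => krTerm m₁ m₂ m₃ m n₁₂ i j k) =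
        if termDegree x = d 1 then
          PowerSeries.coeff (d 0) (PowerSeries.X ^ termDegree x ^ 2 * termCoeff x) else 0 := by
      obtain ⟨m₁, m₂, m₃, m, n, i, j, k⟩ := x
      exact (congrArg _ (krTerm_eq ..)).trans (coeff_toQT_mul_tvar_pow ..)
    have hsum : MvPowerSeries.coeff d krSeries = ∑ x ∈ s, if termDegree x = d 1 then
        PowerSeries.coeff (d 0) (PowerSeries.X ^ termDegree x ^ 2 * termCoeff x) else 0 := by
      change (krOne (d 0) (d 1) : ℤ) = _
      rw [krOne_eq_coeff, listGF_eq_multiSeries, ← hs, Finset.mul_sum, map_sum]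
      refine Finset.sum_congr rfl fun x hx => ?_
      rw [if_pos (hd x hx), hd x hx]
    simp only [hterm, hsum]
    -- For a fixed monomial the exponent of `t` selects a locally finite degree, so only finitely
    -- many summands contribute and convergence is a finite sum.
    refine hasSum_sum_of_ne_finset_zero fun x hx => ?_
    split_ifs with hx'
    · by_cases hc : termCoeff x = 0
      · rw [hc, mul_zero, map_zero]
      · exact absurd (hm x hx' hc) hx
    · rfl
  · intro m₁ m₂ m₃ m n i j k d
    rw [krTerm_eq, coeff_toQT_mul_tvar_pow]
    split_ifs
    · exact (CoeffNonneg.X_pow _).mul (CoeffNonneg.termCoeff _) _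
    · exact le_rfl
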